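/- Let $n\ge 1$ and $s\in(0,1)$. For $t\in\mathbb R$ let $$g_s(t)=\frac{1}{(1+t^2)^{\frac{n+1+s}{2}}},\qquad G_s(t)=\int_0^t g_s(\tau)\,d\tau,\qquad \mathcal G_s(t)=\int_0^t G_s(\tau)\,d\tau .$$ For an open set $\Omega\subset\mathbb R^n$ put $\mathcal C\Omega=\mathbb R^n\setminus\Omega$, $Q(\Omega)=\mathbb R^{2n}\setminus(\mathcal C\Omega)^2$ and, for $\delta>0$, $\Omega_\delta=\{x\in\mathbb R^n : d(x,\Omega)-d(x,\mathcal C\Omega)<\delta\}$. Let $W^{s,1}(\Omega)$ be the space of $u\in L^1(\Omega)$ with $\int_\Omega\int_\Omega\frac{|u(x)-u(y)|}{|x-y|^{n+s}}\,dx\,dy<\infty$. For a measurable $\varphi:\mathbb R^n\to\mathbb R$, an open set $A\subset\Omega$ and $\psi\in L^\infty(A)$, let $$\mathcal W^s_{\varphi,\psi}(\Omega,A)=\{u:\mathbb R^n\to\mathbb R \;:\; u|_\Omega\in W^{s,1}(\Omega),\ u=\varphi \text{ on }\mathcal C\Omega,\ u\ge\psi\text{ a.e. in }A\}.$$ A function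 $u\in\mathcal W^s_{\varphi,\psi}(\Omega,A)$ *solves the obstacle problem* if for every $v\in\mathcal W^s_{\varphi,\psi}(\Omega,A)$ the integral $$\iint_{Q(\Omega)}\left\{\mathcal G_s\Big(\frac{u(x)-u(y)}{|x-y|}\Big)-\mathcal G_s\Big(\frac{v(x)-v(y)}{|x-y|}\Big)\right\}\frac{dx\,dy}{|x-y|^{n-1+s}}$$ converges absolutely and is $\le 0$; that is, $u$ minimizes $\mathcal F_s(u,\Omega)=\iint_{Q(\Omega)}\mathcal G_s\big(\frac{u(x)-u(y)}{|x-y|}\big)\frac{dx\,dy}{|x-y|^{n-1+s}}$ in $\mathcal W^s_{\varphi,\psi}(\Omega,A)$ in the sense of differences. **Theorem.** There exists a constant $\Theta=\Theta(n,s)>1$, depending only on $n$ and $s$, with the following property. Let $\Omega\subset\mathbb R^n$ be a bounded open set with Lipschitz boundary, let $A\subset\Omega$ be open, let $\psi\in L^\infty(A)$, and let $\varphi:\mathbb R^n\to\mathbb R$ be measurable with $\varphi\in L^\infty(\Omega_{\Theta\operatorname{diam}\Omega}\setminus\Omega)$. Then there exists a function $u\in\mathcal W^s_{\varphi,\psi}(\Omega,A)$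 that solves the obstacle problem, and it is unique up to equality almost everywhere. Moreover $$\|u\|_{L^\infty(\Omega)}\le\operatorname{diam}\Omega+\max\big\{\|\varphi\|_{L^\infty(\Omega_{\Theta\operatorname{diam}\Omega}\setminus\Omega)},\ \|\psi\|_{L^\infty(A)}\big\}.$$ -/

import Mathlib

open MeasureTheory

namespace NonlocalObstacle

/-- `ℝⁿ` with its Euclidean norm. -/
abbrev Eucl (n : ℕ) : Type := EuclideanSpace ℝ (Fin n)

/-- `g_s(t) = (1 + t²)^(-(n+1+s)/2)`. -/
noncomputable def g (n : ℕ) (s t : ℝ) : ℝ :=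
  1 / (1 + t ^ 2) ^ (((n : ℝ) + 1 + s) / 2)

/-- `G_s(t) = ∫₀ᵗ g_s(τ) dτ`. -/
noncomputable def G (n : ℕ) (s t : ℝ) : ℝ :=
  ∫ τ in (0 : ℝ)..t, g n s τ

/-- `𝒢_s(t) = ∫₀ᵗ G_s(τ) dτ`. -/
noncomputable def scriptG (n : ℕ) (s t : ℝ) : ℝ :=
  ∫ τ in (0 : ℝ)..t, G n s τ

/-- The integrand of the nonlocal area functional `𝓕_s`, at the pair `p = (x, y)`:
`𝒢_s((u(x) - u(y)) / |x - y|) / |x - y|^(n-1+s)`. -/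
noncomputable def areaIntegrand (n : ℕ) (s : ℝ) (u : Eucl n → ℝ) (p : Eucl n × Eucl n) : ℝ :=
  scriptG n s ((u p.1 - u p.2) / ‖p.1 - p.2‖) / ‖p.1 - p.2‖ ^ ((n : ℝ) - 1 + s)

/-- `Q(Ω) = ℝ²ⁿ ∖ (ℝⁿ ∖ Ω)²`. -/
def Q {n : ℕ} (Ω : Set (Eucl n)) : Set (Eucl n × Eucl n) :=
  (Ωᶜ ×ˢ Ωᶜ)ᶜ

/-- `Ω` has Lipschitz boundary: near every boundary point, in the coordinates given by some unit
vector `e` and the hyperplane orthogonal to `e`, the set `Ω` is the open region strictly above the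
graph of a Lipschitz function. Here `y - ⟪e, y⟫ e` is the orthogonal projection of `y` on that
hyperplane; only the values of `γ` on the hyperplane are used. -/
def HasLipschitzBoundary {n : ℕ} (Ω : Set (Eucl n)) : Prop :=
  ∀ x ∈ frontier Ω, ∃ (e : Eucl n) (γ : Eucl n → ℝ) (K : NNReal) (r : ℝ),
    ‖e‖ = 1 ∧ LipschitzWith K γ ∧ 0 < r ∧
      ∀ y ∈ Metric.ball x r, y ∈ Ω ↔ γ (y - inner ℝ e y • e) < inner ℝ e y

/-- The signed distance from the boundary of `Ω`, negative inside `Ω`. -/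
noncomputable def signedDist {n : ℕ} (Ω : Set (Eucl n)) (x : Eucl n) : ℝ :=
  Metric.infDist x Ω - Metric.infDist x Ωᶜ

/-- `Ω_δ`, the set of points whose signed distance from the boundary of `Ω` is less than `δ`. -/
def neighborhood {n : ℕ} (Ω : Set (Eucl n)) (δ : ℝ) : Set (Eucl n) :=
  {x | signedDist Ω x < δ}

/-- The Gagliardo seminorm `[u]_{W^{s,1}(Ω)}`, with values in `[0, ∞]`. -/
noncomputable def gagliardo {n : ℕ} (s : ℝ) (u : Eucl n → ℝ) (Ω : Set (Eucl n)) : ENNReal :=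
  ∫⁻ x in Ω, ∫⁻ y in Ω, ENNReal.ofReal (|u x - u y| / ‖x - y‖ ^ ((n : ℝ) + s))

/-- `𝒲^s(Ω)`: the functions on `ℝⁿ` whose restriction to `Ω` belongs to `W^{s,1}(Ω)`. -/
def W {n : ℕ} (s : ℝ) (Ω : Set (Eucl n)) : Set (Eucl n → ℝ) :=
  {u | IntegrableOn u Ω ∧ gagliardo s u Ω < ⊤}

/-- `𝒲^s_φ(Ω)`: exterior data `φ`. -/
def WExt {n : ℕ} (s : ℝ) (Ω : Set (Eucl n)) (φ : Eucl n → ℝ) : Set (Eucl n → ℝ) :=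
  {u | u ∈ W s Ω ∧ ∀ x ∈ Ωᶜ, u x = φ x}

/-- `𝒲^s_{φ,ψ}(Ω, A)`: exterior data `φ`, and obstacle `ψ` in `A`. -/
def WObst {n : ℕ} (s : ℝ) (Ω A : Set (Eucl n)) (φ ψ : Eucl n → ℝ) : Set (Eucl n → ℝ) :=
  {u | u ∈ WExt s Ω φ ∧ ∀ᵐ x ∂(volume.restrict A), ψ x ≤ u x}

/-- `u` solves the obstacle problem: it minimizes `𝓕_s` in `𝒲^s_{φ,ψ}(Ω, A)`, in the sense that
for every competitor `v` the integral over `Q(Ω)` of the difference of the integrands converges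
absolutely and is nonpositive (each of the two energies alone may be infinite). -/
def SolvesObstacleProblem {n : ℕ} (s : ℝ) (Ω A : Set (Eucl n)) (φ ψ u : Eucl n → ℝ) : Prop :=
  u ∈ WObst s Ω A φ ψ ∧
    ∀ v ∈ WObst s Ω A φ ψ,
      IntegrableOn (fun p => areaIntegrand n s u p - areaIntegrand n s v p) (Q Ω) ∧
        ∫ p in Q Ω, (areaIntegrand n s u p - areaIntegrand n s v p) ≤ 0

end NonlocalObstacle

/-!
Existence and the bound come from the direct method, run on competitors bounded by
`N = diam Ω + max (‖φ‖, ‖ψ‖)`, together with the fact that truncation at the level `N` never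
increases the energy. Each energy alone may be infinite, because `φ` is arbitrary far from `Ω`;
everything is therefore done with differences of energies.

*Energy differences are finite.* As `G_s` is bounded, `𝒢_s` is Lipschitz, so two competitors `u`,
`v` have integrands that differ by at most `2 |d(x) - d(y)| / |x - y|^(n+s)` with `d = u - v`, which
vanishes outside `Ω`. The integral of this bound over `Ω × Ωᶜ` is `2 ∫_Ω |d| w`, where
`w(x) = ∫_{Ωᶜ} |x - y|^(-(n+s)) dy` is at most of the order of the distance to the boundary
to the power `-s`, and it is finite by the fractional Hardy inequality (`fractional_hardy`). That
inequality is where the regularity of the boundary and `s < 1` enter: if `t` is the vertical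
height above a boundary graph, the integral `A(a)` of `|u|` over the layer `{0 < t ≤ a}` satisfies
`A(a) ≤ A(3 Λ a) / Λ + C a^s E(a)`, where `E(a)` is the part of the Gagliardo seminorm from pairs
at distance comparable to `a` (`layer_comparison`). Multiplied by `a^(-s)` and summed over
`a = a₀ (3 Λ)^(-k)`, the first term is absorbed when `(3 Λ)^s / Λ ≤ 1 / 2`, and the `E(a)` add up to
at most the seminorm (`local_hardy`).

*Truncation.* Let `D = diam Ω`, and let `u(x) > N` at a point `x ∈ Ω`. All `y` with
`D < |x - y| < 2 D` are outside `Ω` and near it, so that `φ(y) ≤ N - D`, and lowering `u(x)` to `N`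
gains at least a fixed multiple of `(u(x) - N) D^(-s)` from them. Only those `y` with
`|x - y| ≥ Θ D` can produce a loss, and it is at most a multiple of `(u(x) - N) (Θ D)^(-s)`. For
large `Θ`, depending on `n` and `s` only, the balance is favourable
(`integral_sub_truncate_nonneg`).

*Existence.* Among competitors bounded by `N`, the energy relative to a fixed competitor is bounded
below, convex and, by Fatou's lemma, lower semicontinuous in `L²(Ω)`, so its sublevel sets are
closed and convex in a bounded subset of a Hilbert space, and it has a minimizer
(`exists_minimizer_of_convex`, `exists_bounded_minimizer`). By truncation this minimizer is optimal
among all competitors.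

*Uniqueness.* `𝒢_s` is strictly convex, so two solutions have the same differences
`u(x) - u(y)` on `Q(Ω)`, and they agree outside `Ω` (`SolvesObstacleProblem.ae_eq`).
-/

namespace NonlocalObstacle

variable {n : ℕ} {s : ℝ}

/-! ### The scalar functions `G_s` and `𝒢_s` -/

lemma continuous_g (n : ℕ) (s : ℝ) : Continuous (g n s) := by
  unfold g
  refine continuous_const.div ?_ fun t => ?_
  · exact (by fun_prop : Continuous fun t : ℝ => 1 + t ^ 2).rpow_const
      fun t => Or.inl (by positivity)
  · positivity

lemma g_pos (n : ℕ) (s t : ℝ) : 0 < g n s t := by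
  unfold g; positivity

lemma g_neg (n : ℕ) (s t : ℝ) : g n s (-t) = g n s t := by
  simp [g]

lemma g_le (hn : 1 ≤ n) (hs : 0 < s) (t : ℝ) : g n s t ≤ (1 + t ^ 2)⁻¹ := by
  unfold g
  rw [one_div]
  have hn' : (1 : ℝ) ≤ n := by exact_mod_cast hn
  refine inv_anti₀ (by positivity) ?_
  refine Real.self_le_rpow_of_one_le (by nlinarith [sq_nonneg t]) (by linarith)

lemma hasDerivAt_G (n : ℕ) (s t : ℝ) : HasDerivAt (G n s) (g n s t) t :=
  intervalIntegral.integral_hasDerivAt_right ((continuous_g n s).intervalIntegrable _ _)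
    ((continuous_g n s).stronglyMeasurableAtFilter _ _) (continuous_g n s).continuousAt

lemma continuous_G (n : ℕ) (s : ℝ) : Continuous (G n s) :=
  continuous_iff_continuousAt.2 fun t => (hasDerivAt_G n s t).continuousAt

lemma strictMono_G (n : ℕ) (s : ℝ) : StrictMono (G n s) :=
  strictMono_of_hasDerivAt_pos (hasDerivAt_G n s) (g_pos n s)

@[simp] lemma G_zero (n : ℕ) (s : ℝ) : G n s 0 = 0 := by simp [G]

lemma G_neg (n : ℕ) (s t : ℝ) : G n s (-t) = -G n s t := by
  have := intervalIntegral.integral_comp_neg (a := 0) (b := t) (g n s)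
  simp only [g_neg, neg_zero] at this
  rw [G, intervalIntegral.integral_symm, ← this, G]

lemma abs_G_le (hn : 1 ≤ n) (hs : 0 < s) (t : ℝ) : |G n s t| ≤ 2 := by
  have key : ∀ t, 0 ≤ t → |G n s t| ≤ 2 := fun t ht => by
    have h0 : 0 ≤ G n s t := by
      simpa using (strictMono_G n s).monotone ht
    rw [abs_of_nonneg h0]
    have : G n s t ≤ ∫ τ in (0 : ℝ)..t, (1 + τ ^ 2)⁻¹ := by
      refine intervalIntegral.integral_mono_on ht ((continuous_g n s).intervalIntegrable _ _) ?_
        fun x _ => g_le hn hs x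
      exact intervalIntegral.intervalIntegrable_inv_one_add_sq
    rw [integral_inv_one_add_sq, Real.arctan_zero, sub_zero] at this
    -- `G_s ≤ arctan < π / 2 ≤ 2`
    linarith [Real.arctan_lt_pi_div_two t, Real.pi_le_four]
  rcases le_total 0 t with h | h
  · exact key t h
  · have := key (-t) (by linarith)
    rwa [G_neg, abs_neg] at this

lemma hasDerivAt_scriptG (n : ℕ) (s t : ℝ) : HasDerivAt (scriptG n s) (G n s t) t :=
  intervalIntegral.integral_hasDerivAt_right ((continuous_G n s).intervalIntegrable _ _)
    ((continuous_G n s).stronglyMeasurableAtFilter _ _) (continuous_G n s).continuousAt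

lemma continuous_scriptG (n : ℕ) (s : ℝ) : Continuous (scriptG n s) :=
  continuous_iff_continuousAt.2 fun t => (hasDerivAt_scriptG n s t).continuousAt

@[simp] lemma scriptG_zero (n : ℕ) (s : ℝ) : scriptG n s 0 = 0 := by simp [scriptG]

lemma scriptG_neg (n : ℕ) (s t : ℝ) : scriptG n s (-t) = scriptG n s t := by
  have := intervalIntegral.integral_comp_neg (a := 0) (b := t) (G n s)
  simp only [G_neg, neg_zero, intervalIntegral.integral_neg] at this
  rw [scriptG, intervalIntegral.integral_symm, ← this, neg_neg, scriptG]

lemma strictConvexOn_scriptG (n : ℕ) (s : ℝ) : StrictConvexOn ℝ Set.univ (scriptG n s) := by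
  refine StrictMono.strictConvexOn_univ_of_deriv (continuous_scriptG n s) ?_
  rw [show deriv (scriptG n s) = G n s from funext fun t => (hasDerivAt_scriptG n s t).deriv]
  exact strictMono_G n s

/-- The tangent line of `𝒢_s` at `b` lies below its graph. -/
lemma scriptG_tangent_le (n : ℕ) (s a b : ℝ) :
    scriptG n s b + G n s b * (a - b) ≤ scriptG n s a := by
  have hc := (strictConvexOn_scriptG n s).convexOn
  rcases lt_trichotomy a b with h | rfl | h
  · have := hc.slope_le_of_hasDerivAt (Set.mem_univ a) (Set.mem_univ b) h (hasDerivAt_scriptG n s b)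
    rw [slope_def_field, div_le_iff₀ (by linarith)] at this
    linarith
  · simp
  · have := hc.le_slope_of_hasDerivAt (Set.mem_univ b) (Set.mem_univ a) h (hasDerivAt_scriptG n s b)
    rw [slope_def_field, le_div_iff₀ (by linarith)] at this
    linarith

lemma scriptG_nonneg (n : ℕ) (s t : ℝ) : 0 ≤ scriptG n s t := by
  simpa using scriptG_tangent_le n s t 0

lemma scriptG_sub_le (hn : 1 ≤ n) (hs : 0 < s) (a b : ℝ) :
    |scriptG n s a - scriptG n s b| ≤ 2 * |a - b| := by
  have key : ∀ a b, scriptG n s a - scriptG n s b ≤ 2 * |a - b| := fun a b => by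
    have h1 := scriptG_tangent_le n s b a
    have h2 : G n s a * (a - b) ≤ |G n s a| * |a - b| := by
      rw [← abs_mul]; exact le_abs_self _
    have h3 := mul_le_mul_of_nonneg_right (abs_G_le hn hs a) (abs_nonneg (a - b))
    linarith
  rw [abs_le]
  constructor
  · have := key b a
    rw [abs_sub_comm] at this
    linarith
  · exact key a b

/-- Linear growth of `𝒢_s`. -/
lemma abs_le_scriptG (n : ℕ) (s t : ℝ) : |t| ≤ scriptG n s t / G n s 1 + 1 := by
  have hG : 0 < G n s 1 := by simpa using strictMono_G n s one_pos
  have key : ∀ t, t ≤ scriptG n s t / G n s 1 + 1 := fun t => by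
    have h1 := scriptG_tangent_le n s t 1
    have h2 := scriptG_nonneg n s 1
    rw [← sub_le_iff_le_add, le_div_iff₀ hG]
    linarith
  rw [abs_le]
  have := key (-t)
  rw [scriptG_neg] at this
  exact ⟨by linarith, key t⟩

/-- `𝒢_s` is monotone in the absolute value of its argument. -/
lemma scriptG_mono_abs {a b : ℝ} (h : |a| ≤ |b|) : scriptG n s a ≤ scriptG n s b := by
  have habs : ∀ t, scriptG n s |t| = scriptG n s t := fun t => by
    rcases abs_choice t with h | h <;> rw [h]
    exact scriptG_neg n s t
  rw [← habs a, ← habs b]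
  have h1 := scriptG_tangent_le n s |b| |a|
  have h2 : 0 ≤ G n s |a| := by simpa using (strictMono_G n s).monotone (abs_nonneg a)
  nlinarith [sub_nonneg.2 h]

/-- The contribution to the nonlocal area functional of a pair of points at distance `r` at which
the values of the function differ by `a`. -/
noncomputable def pairEnergy (n : ℕ) (s r a : ℝ) : ℝ :=
  scriptG n s (a / r) / r ^ ((n : ℝ) - 1 + s)

lemma areaIntegrand_eq (u : Eucl n → ℝ) (p : Eucl n × Eucl n) :
    areaIntegrand n s u p = pairEnergy n s ‖p.1 - p.2‖ (u p.1 - u p.2) := rfl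

lemma pairEnergy_zero (n : ℕ) (s r : ℝ) : pairEnergy n s r 0 = 0 := by simp [pairEnergy]

lemma pairEnergy_zero_left (n : ℕ) (s a : ℝ) : pairEnergy n s 0 a = 0 := by simp [pairEnergy]

lemma pairEnergy_neg (n : ℕ) (s r a : ℝ) : pairEnergy n s r (-a) = pairEnergy n s r a := by
  simp [pairEnergy, neg_div, scriptG_neg]

lemma pairEnergy_nonneg {r : ℝ} (hr : 0 ≤ r) (a : ℝ) : 0 ≤ pairEnergy n s r a :=
  div_nonneg (scriptG_nonneg n s _) (Real.rpow_nonneg hr _)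

lemma rpow_add_eq {r : ℝ} (hr : 0 < r) :
    r ^ ((n : ℝ) + s) = r * r ^ ((n : ℝ) - 1 + s) := by
  rw [show (n : ℝ) + s = 1 + ((n : ℝ) - 1 + s) by ring, Real.rpow_add hr, Real.rpow_one]

lemma pairEnergy_sub_le (hn : 1 ≤ n) (hs : 0 < s) {r : ℝ} (hr : 0 ≤ r) (a b : ℝ) :
    |pairEnergy n s r a - pairEnergy n s r b| ≤ 2 * (|a - b| / r ^ ((n : ℝ) + s)) := by
  rcases hr.eq_or_lt with rfl | hr
  · simp only [pairEnergy_zero_left, sub_self, abs_zero]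
    positivity
  have hr' : 0 < r ^ ((n : ℝ) - 1 + s) := Real.rpow_pos_of_pos hr _
  rw [pairEnergy, pairEnergy, ← sub_div, abs_div, abs_of_pos hr', rpow_add_eq hr,
    div_le_iff₀ hr']
  refine (scriptG_sub_le hn hs _ _).trans_eq ?_
  rw [← sub_div, abs_div, abs_of_pos hr]
  field_simp

lemma pairEnergy_le_add {r : ℝ} (hr : 0 < r) (a : ℝ) :
    |a| / r ^ ((n : ℝ) + s) ≤
      (G n s 1)⁻¹ * pairEnergy n s r a + (r ^ ((n : ℝ) - 1 + s))⁻¹ := by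
  have hr' : 0 < r ^ ((n : ℝ) - 1 + s) := Real.rpow_pos_of_pos hr _
  have h := abs_le_scriptG n s (a / r)
  rw [abs_div, abs_of_pos hr] at h
  calc |a| / r ^ ((n : ℝ) + s) = (|a| / r) / r ^ ((n : ℝ) - 1 + s) := by
        rw [rpow_add_eq hr, div_div]
    _ ≤ (scriptG n s (a / r) / G n s 1 + 1) / r ^ ((n : ℝ) - 1 + s) := by gcongr
    _ = _ := by rw [pairEnergy]; ring

lemma pairEnergy_mono_abs {r : ℝ} (hr : 0 ≤ r) {a b : ℝ} (h : |a| ≤ |b|) :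
    pairEnergy n s r a ≤ pairEnergy n s r b := by
  refine div_le_div_of_nonneg_right (scriptG_mono_abs ?_) (Real.rpow_nonneg hr _)
  rw [abs_div, abs_div]
  gcongr

/-- Where `𝒢_s` has slope at least `G_s(1/2)`, lowering the difference of values lowers the energy
proportionally. -/
lemma pairEnergy_gain {r a b : ℝ} (hr : 0 < r) (hb : r / 2 ≤ b) (hab : b ≤ a) :
    G n s (1 / 2) * ((a - b) / r ^ ((n : ℝ) + s)) ≤ pairEnergy n s r a - pairEnergy n s r b := by
  have hr' : 0 < r ^ ((n : ℝ) - 1 + s) := Real.rpow_pos_of_pos hr _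
  have h := scriptG_tangent_le n s (a / r) (b / r)
  have h2 : G n s (1 / 2) ≤ G n s (b / r) := by
    refine (strictMono_G n s).monotone ?_
    rw [le_div_iff₀ hr]; linarith
  have h3 : 0 ≤ a / r - b / r := by
    rw [← sub_div]; exact div_nonneg (by linarith) hr.le
  rw [pairEnergy, pairEnergy, ← sub_div, rpow_add_eq hr, le_div_iff₀ hr']
  calc G n s (1 / 2) * ((a - b) / (r * r ^ ((n : ℝ) - 1 + s))) * r ^ ((n : ℝ) - 1 + s)
      = G n s (1 / 2) * (a / r - b / r) := by field_simp
    _ ≤ _ := by nlinarith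

lemma pairEnergy_convex {r : ℝ} (hr : 0 ≤ r) {c d : ℝ} (hc : 0 ≤ c) (hd : 0 ≤ d)
    (hcd : c + d = 1) (a b : ℝ) :
    pairEnergy n s r (c * a + d * b) ≤ c * pairEnergy n s r a + d * pairEnergy n s r b := by
  have h := (strictConvexOn_scriptG n s).convexOn.2 (Set.mem_univ (a / r)) (Set.mem_univ (b / r))
    hc hd hcd
  simp only [smul_eq_mul] at h
  calc pairEnergy n s r (c * a + d * b)
      = scriptG n s (c * (a / r) + d * (b / r)) / r ^ ((n : ℝ) - 1 + s) := by
        rw [pairEnergy]; congr 2; ring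
    _ ≤ (c * scriptG n s (a / r) + d * scriptG n s (b / r)) / r ^ ((n : ℝ) - 1 + s) := by gcongr
    _ = _ := by rw [pairEnergy, pairEnergy]; ring

lemma pairEnergy_midpoint_lt {r : ℝ} (hr : 0 < r) {a b : ℝ} (hab : a ≠ b) :
    pairEnergy n s r ((a + b) / 2) < (pairEnergy n s r a + pairEnergy n s r b) / 2 := by
  have hr' : 0 < r ^ ((n : ℝ) - 1 + s) := Real.rpow_pos_of_pos hr _
  have h := (strictConvexOn_scriptG n s).2 (Set.mem_univ (a / r)) (Set.mem_univ (b / r))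
    (by intro h; exact hab (by field_simp at h; exact h)) (one_half_pos) (one_half_pos)
    (add_halves 1)
  simp only [smul_eq_mul] at h
  calc pairEnergy n s r ((a + b) / 2)
      = scriptG n s (1 / 2 * (a / r) + 1 / 2 * (b / r)) / r ^ ((n : ℝ) - 1 + s) := by
        rw [pairEnergy]; congr 2; ring
    _ < (1 / 2 * scriptG n s (a / r) + 1 / 2 * scriptG n s (b / r)) / r ^ ((n : ℝ) - 1 + s) := by
        gcongr
    _ = _ := by rw [pairEnergy, pairEnergy]; ring

/-! ### Integrals of the kernel -/

/-- The kernel `|z|^(-(n+s))` of the fractional seminorm. -/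
noncomputable def kernel (s : ℝ) (z : Eucl n) : ℝ := (‖z‖ ^ ((n : ℝ) + s))⁻¹

lemma kernel_nonneg (z : Eucl n) : 0 ≤ kernel s z := by unfold kernel; positivity

lemma kernel_neg (z : Eucl n) : kernel s (-z) = kernel s z := by simp [kernel]

lemma measurable_kernel : Measurable (kernel s : Eucl n → ℝ) := by
  unfold kernel; fun_prop

lemma kernel_smul {R : ℝ} (hR : 0 < R) (z : Eucl n) :
    kernel s (R • z) = (R ^ ((n : ℝ) + s))⁻¹ * kernel s z := by
  rw [kernel, kernel, norm_smul, Real.norm_of_nonneg hR.le,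
    Real.mul_rpow hR.le (norm_nonneg z), mul_inv]

lemma integrableOn_kernel (hs : 0 < s) {R : ℝ} (hR : 0 < R) :
    IntegrableOn (kernel s) {z : Eucl n | R ≤ ‖z‖} := by
  have hfin : ((Module.finrank ℝ (Eucl n) : ℕ) : ℝ) < (n : ℝ) + s := by
    rw [finrank_euclideanSpace_fin]; linarith
  have hint := (integrable_one_add_norm (E := Eucl n) (μ := volume) hfin).const_mul
    ((1 + 1 / R) ^ ((n : ℝ) + s))
  refine Integrable.mono' hint.integrableOn measurable_kernel.aestronglyMeasurable ?_
  refine (ae_restrict_iff' (measurableSet_le measurable_const measurable_norm)).2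
    (Filter.Eventually.of_forall fun z (hz : R ≤ ‖z‖) => ?_)
  have hz0 : 0 < ‖z‖ := hR.trans_le hz
  rw [Real.norm_of_nonneg (kernel_nonneg z), kernel, Real.rpow_neg (by positivity),
    ← div_eq_mul_inv, le_div_iff₀ (by positivity), inv_mul_le_iff₀ (by positivity),
    ← Real.mul_rpow hz0.le (by positivity)]
  refine Real.rpow_le_rpow (by positivity) ?_ (by positivity)
  have : 1 ≤ ‖z‖ * (1 / R) := by rw [mul_one_div, one_le_div hR]; exact hz
  linarith

open Pointwise in
lemma setIntegral_kernel_smul {R : ℝ} (hR : 0 < R) (B : Set (Eucl n)) :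
    ∫ z in R • B, kernel s z = R ^ (-s) * ∫ z in B, kernel s z := by
  have h := Measure.setIntegral_comp_smul_of_pos volume (kernel s : Eucl n → ℝ) B hR
  simp only [kernel_smul hR, integral_const_mul, finrank_euclideanSpace_fin, smul_eq_mul] at h
  have hRn : (0 : ℝ) < R ^ n := by positivity
  rw [eq_comm, inv_mul_eq_iff_eq_mul₀ hRn.ne'] at h
  rw [h, ← mul_assoc, Real.rpow_add hR, Real.rpow_natCast, Real.rpow_neg hR.le]
  field_simp

open Pointwise in
lemma setIntegral_kernel_far {R : ℝ} (hR : 0 < R) :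
    ∫ z in {z : Eucl n | R ≤ ‖z‖}, kernel s z =
      R ^ (-s) * ∫ z in {z : Eucl n | 1 ≤ ‖z‖}, kernel s z := by
  rw [← setIntegral_kernel_smul hR]
  congr 2
  ext z
  rw [Set.mem_smul_set_iff_inv_smul_mem₀ hR.ne', Set.mem_ofPred_eq, Set.mem_ofPred_eq, norm_smul,
    norm_inv, Real.norm_of_nonneg hR.le, inv_mul_eq_div, one_le_div hR]

open Pointwise in
lemma setIntegral_kernel_annulus {R : ℝ} (hR : 0 < R) :
    ∫ z in {z : Eucl n | R < ‖z‖ ∧ ‖z‖ < 2 * R}, kernel s z =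
      R ^ (-s) * ∫ z in {z : Eucl n | 1 < ‖z‖ ∧ ‖z‖ < 2}, kernel s z := by
  rw [← setIntegral_kernel_smul hR]
  congr 2
  ext z
  rw [Set.mem_smul_set_iff_inv_smul_mem₀ hR.ne', Set.mem_ofPred_eq, Set.mem_ofPred_eq, norm_smul,
    norm_inv, Real.norm_of_nonneg hR.le, inv_mul_eq_div, one_lt_div hR, div_lt_iff₀ hR]

lemma setIntegral_kernel_annulus_pos (hn : 1 ≤ n) (hs : 0 < s) :
    0 < ∫ z in {z : Eucl n | 1 < ‖z‖ ∧ ‖z‖ < 2}, kernel s z := by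
  have hopen : IsOpen {z : Eucl n | 1 < ‖z‖ ∧ ‖z‖ < 2} :=
    (isOpen_lt continuous_const continuous_norm).inter (isOpen_lt continuous_norm continuous_const)
  rw [setIntegral_pos_iff_support_of_nonneg_ae]
  · have hne : ({z : Eucl n | 1 < ‖z‖ ∧ ‖z‖ < 2}).Nonempty := by
      have : NeZero n := ⟨by omega⟩
      obtain ⟨z, hz⟩ := exists_norm_eq (Eucl n) (show (0 : ℝ) ≤ 3 / 2 by norm_num)
      exact ⟨z, by rw [Set.mem_ofPred_eq, hz]; norm_num⟩
    refine (hopen.measure_pos volume hne).trans_le (measure_mono fun z hz => ⟨?_, hz⟩)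
    have : 0 < ‖z‖ := one_pos.trans hz.1
    rw [Function.mem_support, kernel]
    positivity
  · exact Filter.Eventually.of_forall kernel_nonneg
  · exact (integrableOn_kernel hs one_pos).mono_set fun z hz => hz.1.le

lemma lintegral_kernel_far (hs : 0 < s) {R : ℝ} (hR : 0 < R) (x : Eucl n) :
    ∫⁻ y in {y : Eucl n | R ≤ ‖x - y‖}, ENNReal.ofReal (kernel s (x - y)) =
      ENNReal.ofReal (R ^ (-s) * ∫ z in {z : Eucl n | 1 ≤ ‖z‖}, kernel s z) := by
  rw [← setIntegral_kernel_far hR, ofReal_integral_eq_lintegral_ofReal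
    (integrableOn_kernel hs hR) (Filter.Eventually.of_forall kernel_nonneg)]
  exact (Measure.measurePreserving_sub_left volume x).setLIntegral_comp_preimage
    (s := {z : Eucl n | R ≤ ‖z‖}) (f := fun z => ENNReal.ofReal (kernel s z))
    (measurableSet_le measurable_const measurable_norm)
    measurable_kernel.ennreal_ofReal

/-- The weakly singular kernel `|x - y|^(-(n-1+s))` is integrable on the square of a bounded
set. -/
lemma lintegral_weak_kernel_lt_top (hn : 1 ≤ n) (hs1 : s < 1) {Ω : Set (Eucl n)}
    (hb : Bornology.IsBounded Ω) :
    ∫⁻ x in Ω, ∫⁻ y in Ω, ENNReal.ofReal ((‖x - y‖ ^ ((n : ℝ) - 1 + s))⁻¹) < ⊤ := by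
  obtain ⟨R, hR⟩ := hb.subset_ball 0
  have hmeas : Measurable fun z : Eucl n => (‖z‖ ^ ((n : ℝ) - 1 + s))⁻¹ := by fun_prop
  have hint : IntegrableOn (fun z : Eucl n => (‖z‖ ^ ((n : ℝ) - 1 + s))⁻¹)
      (Metric.ball 0 (2 * R)) := by
    refine integrableOn_ball_of_norm_le_rpow (C := 1) (α := (n : ℝ) - 1 + s)
      (by rwa [finrank_euclideanSpace_fin]) (by rw [finrank_euclideanSpace_fin]; linarith) ?_
      hmeas.aestronglyMeasurable
    refine Filter.Eventually.of_forall fun z => ?_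
    rw [one_mul, Real.rpow_neg (norm_nonneg z), Real.norm_of_nonneg (by positivity)]
  have hlt := hint.lintegral_lt_top
  refine lt_of_le_of_lt (b := ∫⁻ x in Ω, ∫⁻ z in Metric.ball (0 : Eucl n) (2 * R),
    ENNReal.ofReal ((‖z‖ ^ ((n : ℝ) - 1 + s))⁻¹)) ?_ ?_
  · refine setLIntegral_mono measurable_const fun x hx => ?_
    have hx' := mem_ball_zero_iff.1 (hR hx)
    rw [← (Measure.measurePreserving_sub_left volume x).setLIntegral_comp_preimage
      Metric.isOpen_ball.measurableSet hmeas.ennreal_ofReal]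
    refine lintegral_mono_set fun y hy => ?_
    have hy' := mem_ball_zero_iff.1 (hR hy)
    rw [Set.mem_preimage, mem_ball_zero_iff]
    linarith [norm_sub_le x y]
  · rw [setLIntegral_const]
    exact ENNReal.mul_lt_top hlt hb.measure_lt_top

/-! ### Comparison of layers near the boundary -/

/-- The pairs of points of `Ω` whose distance is comparable to `a`, up to factors given by `Λ`. -/
def annularPairs (Ω : Set (Eucl n)) (Λ a : ℝ) : Set (Eucl n × Eucl n) :=
  (Ω ×ˢ Ω) ∩ {p | (Λ - 1) * a < ‖p.1 - p.2‖ ∧ ‖p.1 - p.2‖ < (2 * Λ + 1) * a}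

lemma measurableSet_annularPairs {Ω : Set (Eucl n)} (hΩ : MeasurableSet Ω) (Λ a : ℝ) :
    MeasurableSet (annularPairs Ω Λ a) := by
  refine (hΩ.prod hΩ).inter ?_
  have : Measurable fun p : Eucl n × Eucl n => ‖p.1 - p.2‖ := by fun_prop
  exact (measurableSet_lt measurable_const this).inter (measurableSet_lt this measurable_const)

/-- The integrand of the Gagliardo seminorm. -/
noncomputable def gagliardoIntegrand (s : ℝ) (u : Eucl n → ℝ) (p : Eucl n × Eucl n) : ENNReal :=
  ENNReal.ofReal (|u p.1 - u p.2| * kernel s (p.1 - p.2))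

lemma measurable_gagliardoIntegrand {u : Eucl n → ℝ} (hu : Measurable u) :
    Measurable (gagliardoIntegrand s u) := by
  unfold gagliardoIntegrand
  have : Measurable fun p : Eucl n × Eucl n => kernel s (p.1 - p.2) :=
    measurable_kernel.comp (by fun_prop)
  fun_prop

lemma gagliardo_eq (u : Eucl n → ℝ) (Ω : Set (Eucl n)) :
    gagliardo s u Ω = ∫⁻ x in Ω, ∫⁻ y in Ω, gagliardoIntegrand s u (x, y) := rfl

lemma gagliardo_eq_prod {u : Eucl n → ℝ} (hu : Measurable u) (Ω : Set (Eucl n)) :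
    gagliardo s u Ω = ∫⁻ p in Ω ×ˢ Ω, gagliardoIntegrand s u p := by
  rw [gagliardo_eq, Measure.volume_eq_prod, ← Measure.prod_restrict,
    lintegral_prod _ (measurable_gagliardoIntegrand hu).aemeasurable]

/-- The layer of height `a` above a graph, described by the height function `t`, in a ball. -/
def layer (t : Eucl n → ℝ) (x₀ : Eucl n) (ρ a : ℝ) : Set (Eucl n) :=
  {x | x ∈ Metric.ball x₀ ρ ∧ 0 < t x ∧ t x ≤ a}

lemma measurableSet_layer {t : Eucl n → ℝ} (ht : Continuous t) (x₀ : Eucl n) (ρ a : ℝ) :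
    MeasurableSet (layer t x₀ ρ a) :=
  Metric.isOpen_ball.measurableSet.inter
    ((measurableSet_lt measurable_const ht.measurable).inter
      (measurableSet_le ht.measurable measurable_const))

/-- Displacing a layer upwards: the displaced points lie in the layer that is `3 Λ` times as
high. -/
lemma add_mem_layer {t : Eucl n → ℝ} {e x₀ : Eucl n} {L : NNReal} (ht : LipschitzWith L t)
    (he : ‖e‖ = 1) (hte : ∀ z τ, t (z + τ • e) = t z + τ) {Λ a ρ τ : ℝ} (hΛ : 3 ≤ Λ) (ha : 0 < a)
    (hτ : τ ∈ Set.Icc (Λ * a) (2 * Λ * a)) {η x : Eucl n} (hη : ‖η‖ < a / (2 * (L + 1)))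
    (hx : x ∈ layer t x₀ (ρ + a) a) :
    x + (τ • e + η) ∈ layer t x₀ (ρ + 3 * Λ * a) (3 * Λ * a) ∧
      (Λ - 1) * a < ‖τ • e + η‖ ∧ ‖τ • e + η‖ < (2 * Λ + 1) * a := by
  obtain ⟨hx, hx0, hxa⟩ := hx
  have hL : (0 : ℝ) ≤ L := L.2
  have hη2 : (L + 1) * ‖η‖ < a / 2 := by
    rw [lt_div_iff₀ (by positivity)] at hη
    linarith
  have hη1 : ‖η‖ < a / 2 := by nlinarith [norm_nonneg η]
  have hτ0 : 0 < τ := lt_of_lt_of_le (by positivity) hτ.1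
  have hτe : ‖τ • e‖ = τ := by rw [norm_smul, he, mul_one, Real.norm_of_nonneg hτ0.le]
  have hlow : τ - ‖η‖ ≤ ‖τ • e + η‖ := by
    have := norm_sub_norm_le (τ • e) (-η)
    rwa [hτe, norm_neg, sub_neg_eq_add] at this
  have hup : ‖τ • e + η‖ ≤ τ + ‖η‖ := by
    have := norm_add_le (τ • e) η
    rwa [hτe] at this
  have ht1 : |t (x + (τ • e + η)) - (t x + τ)| ≤ L * ‖η‖ := by
    rw [← hte x τ, ← Real.dist_eq, ← add_assoc]
    refine (ht.dist_le_mul _ _).trans_eq ?_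
    rw [dist_eq_norm, add_sub_cancel_left]
  have ht2 : L * ‖η‖ < a / 2 := by nlinarith [norm_nonneg η]
  rw [abs_le] at ht1
  rw [mem_ball_iff_norm] at hx
  refine ⟨⟨?_, ?_, ?_⟩, ?_, ?_⟩
  · rw [mem_ball_iff_norm, show x + (τ • e + η) - x₀ = (x - x₀) + (τ • e + η) by abel]
    have := norm_add_le (x - x₀) (τ • e + η)
    nlinarith [hτ.2]
  · nlinarith [hτ.1]
  · nlinarith [hτ.2]
  · nlinarith [hτ.1]
  · nlinarith [hτ.2]

/-- The multiplicative form of the comparison of two layers: the mean over the displacements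
`τ e + η` of the integral of `|u|` over the displaced layer is small, because for fixed `y` and `η`
the `τ` for which `y - τ e - η` lies in the layer form an interval of length `a`. -/
lemma layer_comparison_aux {t : Eucl n → ℝ} {e x₀ : Eucl n} {L : NNReal} (ht : LipschitzWith L t)
    (he : ‖e‖ = 1) (hte : ∀ z τ, t (z + τ • e) = t z + τ) {Λ a ρ : ℝ} (hΛ : 3 ≤ Λ) (ha : 0 < a)
    (hs : 0 < s) {Ω : Set (Eucl n)} (hΩ : MeasurableSet Ω)
    (hsub : layer t x₀ (ρ + 3 * Λ * a) (3 * Λ * a) ⊆ Ω) {u : Eucl n → ℝ} (hu : Measurable u) :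
    ENNReal.ofReal (Λ * a) * volume (Metric.ball (0 : Eucl n) (a / (2 * (L + 1)))) *
        ∫⁻ x in layer t x₀ (ρ + a) a, ‖u x‖ₑ ≤
      volume (Metric.ball (0 : Eucl n) (a / (2 * (L + 1)))) * (ENNReal.ofReal a *
          ∫⁻ x in layer t x₀ (ρ + 3 * Λ * a) (3 * Λ * a), ‖u x‖ₑ) +
        ENNReal.ofReal (Λ * a) * (ENNReal.ofReal (((2 * Λ + 1) * a) ^ ((n : ℝ) + s)) *
          ∫⁻ p in annularPairs Ω Λ a, gagliardoIntegrand s u p) := by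
  set U := layer t x₀ (ρ + a) a with hU
  set U' := layer t x₀ (ρ + 3 * Λ * a) (3 * Λ * a) with hU'
  set B := Metric.ball (0 : Eucl n) (a / (2 * (L + 1))) with hB
  set I := Set.Icc (Λ * a) (2 * Λ * a) with hI
  have hUm : MeasurableSet U := measurableSet_layer ht.continuous _ _ _
  have hUm' : MeasurableSet U' := measurableSet_layer ht.continuous _ _ _
  have hBm : MeasurableSet B := Metric.isOpen_ball.measurableSet
  have hIm : MeasurableSet I := measurableSet_Icc
  have hvI : volume I = ENNReal.ofReal (Λ * a) := by
    rw [hI, Real.volume_Icc]; congr 1; ring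
  have hUsub : U ⊆ U' := by
    rintro x ⟨hx, hx0, hxa⟩
    have : a ≤ 3 * Λ * a := by nlinarith
    exact ⟨Metric.ball_subset_ball (by linarith) hx, hx0, hxa.trans this⟩
  -- the integral over the displaced layer, and the error made by the displacement
  let p : ℝ × Eucl n → ENNReal := fun q => ∫⁻ x in U, ‖u (x + (q.1 • e + q.2))‖ₑ
  let d : ℝ × Eucl n → ENNReal := fun q => ∫⁻ x in U, ‖u x - u (x + (q.1 • e + q.2))‖ₑ
  have hshift : Measurable fun z : (ℝ × Eucl n) × Eucl n => u (z.2 + (z.1.1 • e + z.1.2)) :=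
    hu.comp (by fun_prop)
  have hp : Measurable p := Measurable.lintegral_prod_right' hshift.enorm
  have hd : Measurable d :=
    Measurable.lintegral_prod_right' ((hu.comp measurable_snd).sub hshift).enorm
  have hle : ∀ q, ∫⁻ x in U, ‖u x‖ₑ ≤ p q + d q := fun q => by
    have hm : Measurable fun x => u (x + (q.1 • e + q.2)) := hu.comp (by fun_prop)
    rw [← lintegral_add_left hm.enorm]
    refine lintegral_mono fun x => ?_
    calc ‖u x‖ₑ = ‖u (x + (q.1 • e + q.2)) + (u x - u (x + (q.1 • e + q.2)))‖ₑ := by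
          congr 1; ring
      _ ≤ _ := enorm_add_le _ _
  have hstart : ENNReal.ofReal (Λ * a) * volume B * ∫⁻ x in U, ‖u x‖ₑ ≤
      (∫⁻ η in B, ∫⁻ τ in I, p (τ, η)) + ∫⁻ τ in I, ∫⁻ η in B, d (τ, η) := by
    rw [← lintegral_prod_symm p hp.aemeasurable, ← lintegral_prod d hd.aemeasurable,
      ← lintegral_add_left hp]
    calc _ = ∫⁻ q, (∫⁻ x in U, ‖u x‖ₑ) ∂((volume.restrict I).prod (volume.restrict B)) := by
          rw [lintegral_const, Measure.prod_restrict, Measure.restrict_apply_univ,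
            Measure.prod_prod, hvI, mul_comm]
      _ ≤ _ := lintegral_mono hle
  refine hstart.trans (add_le_add ?_ ?_)
  -- first term: for fixed `η`, integrate over `τ` before `y`
  · have hη : ∀ η ∈ B, ∫⁻ τ in I, p (τ, η) ≤ ENNReal.ofReal a * ∫⁻ x in U', ‖u x‖ₑ := by
      intro η hηB
      have hηn := mem_ball_zero_iff.1 hηB
      have h1 : ∀ τ ∈ I, p (τ, η) ≤
          ∫⁻ y in U', ‖u y‖ₑ * (Set.Ico (t (y - η) - a) (t (y - η))).indicator 1 τ := by
        intro τ hτ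
        calc p (τ, η) = ∫⁻ x, U.indicator (fun x => ‖u (x + (τ • e + η))‖ₑ) x :=
              (lintegral_indicator hUm _).symm
          _ = ∫⁻ y, U.indicator (fun x => ‖u (x + (τ • e + η))‖ₑ) (y - (τ • e + η)) :=
              (lintegral_sub_right_eq_self _ _).symm
          _ ≤ ∫⁻ y, U'.indicator (fun y => ‖u y‖ₑ *
                (Set.Ico (t (y - η) - a) (t (y - η))).indicator 1 τ) y := by
              refine lintegral_mono fun y => ?_
              by_cases hy : y - (τ • e + η) ∈ U
              · have hy' := (add_mem_layer ht he hte hΛ ha hτ hηn hy).1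
                have htz := hte (y - (τ • e + η)) τ
                rw [show y - (τ • e + η) + τ • e = y - η by abel] at htz
                have hmem : τ ∈ Set.Ico (t (y - η) - a) (t (y - η)) :=
                  ⟨by linarith [hy.2.2], by linarith [hy.2.1]⟩
                rw [sub_add_cancel] at hy'
                rw [Set.indicator_of_mem hy, Set.indicator_of_mem hy', Set.indicator_of_mem hmem,
                  sub_add_cancel, Pi.one_apply, mul_one]
              · rw [Set.indicator_of_notMem hy]
                exact zero_le
          _ = _ := lintegral_indicator hUm' _
      calc ∫⁻ τ in I, p (τ, η)
          ≤ ∫⁻ τ in I, ∫⁻ y in U', ‖u y‖ₑ *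
              (Set.Ico (t (y - η) - a) (t (y - η))).indicator 1 τ := setLIntegral_mono' hIm h1
        _ = ∫⁻ y in U', ∫⁻ τ in I, ‖u y‖ₑ *
              (Set.Ico (t (y - η) - a) (t (y - η))).indicator 1 τ := by
            refine lintegral_lintegral_swap (Measurable.aemeasurable ?_)
            have htm : Measurable fun z : ℝ × Eucl n => t (z.2 - η) :=
              ht.continuous.measurable.comp (by fun_prop)
            exact (hu.comp measurable_snd).enorm.mul (measurable_one.indicator
              ((measurableSet_le (htm.sub_const a) measurable_fst).inter
                (measurableSet_lt measurable_fst htm)))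
        _ ≤ ∫⁻ y in U', ‖u y‖ₑ * ENNReal.ofReal a := by
            refine lintegral_mono fun y => ?_
            rw [lintegral_const_mul _ (measurable_one.indicator measurableSet_Ico)]
            gcongr
            refine (setLIntegral_le_lintegral _ _).trans ?_
            rw [lintegral_indicator_one measurableSet_Ico, Real.volume_Ico]
            simp
        _ = _ := by rw [lintegral_mul_const _ hu.enorm, mul_comm]
    calc ∫⁻ η in B, ∫⁻ τ in I, p (τ, η)
        ≤ ∫⁻ η in B, ENNReal.ofReal a * ∫⁻ x in U', ‖u x‖ₑ := setLIntegral_mono' hBm hη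
      _ = _ := by rw [setLIntegral_const, mul_comm]
  -- second term: on the displaced pairs, the seminorm kernel is bounded below by `c⁻¹`
  · set c := ENNReal.ofReal (((2 * Λ + 1) * a) ^ ((n : ℝ) + s)) with hc
    set T := annularPairs Ω Λ a with hT
    have hTm : MeasurableSet T := measurableSet_annularPairs hΩ _ _
    have hFm : Measurable (T.indicator (gagliardoIntegrand s u)) :=
      (measurable_gagliardoIntegrand hu).indicator hTm
    have hτ : ∀ τ ∈ I, ∫⁻ η in B, d (τ, η) ≤ c * ∫⁻ p in T, gagliardoIntegrand s u p := by
      intro τ hτ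
      calc ∫⁻ η in B, d (τ, η)
          = ∫⁻ x in U, ∫⁻ η in B, ‖u x - u (x + (τ • e + η))‖ₑ := by
            refine lintegral_lintegral_swap (Measurable.aemeasurable ?_)
            exact ((hu.comp measurable_snd).sub (hu.comp (by fun_prop))).enorm
        _ ≤ ∫⁻ x in U, ∫⁻ η in B,
              c * T.indicator (gagliardoIntegrand s u) (x, x + (τ • e + η)) := by
            refine setLIntegral_mono' hUm fun x hx => setLIntegral_mono' hBm fun η hη => ?_
            obtain ⟨h1, h2, h3⟩ := add_mem_layer ht he hte hΛ ha hτ (mem_ball_zero_iff.1 hη) hx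
            have hv : x - (x + (τ • e + η)) = -(τ • e + η) := by abel
            have hmem : (x, x + (τ • e + η)) ∈ T :=
              ⟨⟨hsub (hUsub hx), hsub h1⟩, by
                simpa only [Set.mem_ofPred_eq, hv, norm_neg] using ⟨h2, h3⟩⟩
            rw [Set.indicator_of_mem hmem, gagliardoIntegrand, hc,
              ← ENNReal.ofReal_mul (by positivity), Real.enorm_eq_ofReal_abs]
            refine ENNReal.ofReal_le_ofReal ?_
            have hpos : 0 < ‖τ • e + η‖ := lt_of_le_of_lt (by nlinarith) h2
            simp only [hv, kernel, norm_neg]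
            rw [mul_comm, mul_assoc]
            refine le_mul_of_one_le_right (abs_nonneg _) ?_
            rw [inv_mul_eq_div, one_le_div (by positivity)]
            exact Real.rpow_le_rpow hpos.le h3.le (by positivity)
        _ ≤ ∫⁻ x in U, c * ∫⁻ y, T.indicator (gagliardoIntegrand s u) (x, y) := by
            refine lintegral_mono fun x => ?_
            have hm : Measurable fun y => T.indicator (gagliardoIntegrand s u) (x, y) :=
              hFm.comp measurable_prodMk_left
            have hm2 : Measurable fun η =>
                T.indicator (gagliardoIntegrand s u) (x, x + (τ • e + η)) :=
              hm.comp (by fun_prop)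
            rw [lintegral_const_mul _ hm2]
            gcongr c * ?_
            refine (setLIntegral_le_lintegral _ _).trans_eq ?_
            simp_rw [← add_assoc]
            exact lintegral_add_left_eq_self
              (fun y => T.indicator (gagliardoIntegrand s u) (x, y)) (x + τ • e)
        _ ≤ ∫⁻ x, c * ∫⁻ y, T.indicator (gagliardoIntegrand s u) (x, y) :=
            setLIntegral_le_lintegral _ _
        _ = _ := by
            rw [lintegral_const_mul _ hFm.lintegral_prod_right', ← lintegral_indicator hTm,
              Measure.volume_eq_prod, lintegral_prod _ hFm.aemeasurable]
    calc ∫⁻ τ in I, ∫⁻ η in B, d (τ, η)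
        ≤ ∫⁻ τ in I, c * ∫⁻ p in T, gagliardoIntegrand s u p := setLIntegral_mono' hIm hτ
      _ = _ := by rw [setLIntegral_const, hvI, mul_comm]

/-! ### The fractional Hardy inequality near a boundary point -/

/-- Comparison of the integrals of `|u|` over two layers near the boundary, at heights `a` and
`3 Λ a`. The factor `1 / Λ` beats the factor `(3 Λ) ^ s` by which the Hardy weights differ. -/
lemma layer_comparison {t : Eucl n → ℝ} {e x₀ : Eucl n} {L : NNReal} (ht : LipschitzWith L t)
    (he : ‖e‖ = 1) (hte : ∀ z τ, t (z + τ • e) = t z + τ) {Λ : ℝ} (hΛ : 3 ≤ Λ)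
    (hs : 0 < s) {Ω : Set (Eucl n)} (hΩ : MeasurableSet Ω) {u : Eucl n → ℝ} (hu : Measurable u) :
    ∃ C : ℝ, 0 ≤ C ∧ ∀ a ρ : ℝ, 0 < a → layer t x₀ (ρ + 3 * Λ * a) (3 * Λ * a) ⊆ Ω →
      ∫⁻ x in layer t x₀ (ρ + a) a, ‖u x‖ₑ ≤
        ENNReal.ofReal (1 / Λ) *
          (∫⁻ x in layer t x₀ (ρ + 3 * Λ * a) (3 * Λ * a), ‖u x‖ₑ) +
        ENNReal.ofReal (C * a ^ s) * ∫⁻ p in annularPairs Ω Λ a, gagliardoIntegrand s u p := by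
  set β := (volume (Metric.ball (0 : Eucl n) 1)).toReal with hβ
  have hβtop : volume (Metric.ball (0 : Eucl n) 1) ≠ ⊤ := measure_ball_lt_top.ne
  have hβ0 : 0 < β := ENNReal.toReal_pos (Metric.measure_ball_pos _ _ one_pos).ne' hβtop
  have hL : (0 : ℝ) ≤ L := L.2
  set κ : ℝ := 1 / (2 * (L + 1)) with hκ
  have hκ0 : 0 < κ := by positivity
  refine ⟨(2 * Λ + 1) ^ ((n : ℝ) + s) / (κ ^ n * β), by positivity, fun a ρ ha hsub => ?_⟩
  have h := layer_comparison_aux ht he hte hΛ ha hs hΩ hsub hu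
  set A := ∫⁻ x in layer t x₀ (ρ + a) a, ‖u x‖ₑ
  set A' := ∫⁻ x in layer t x₀ (ρ + 3 * Λ * a) (3 * Λ * a), ‖u x‖ₑ
  set E := ∫⁻ p in annularPairs Ω Λ a, gagliardoIntegrand s u p
  have hvol : volume (Metric.ball (0 : Eucl n) (a / (2 * (L + 1)))) =
      ENNReal.ofReal ((κ * a) ^ n * β) := by
    rw [Measure.addHaar_ball_of_pos _ _ (by positivity), finrank_euclideanSpace_fin,
      ENNReal.ofReal_mul (by positivity), hβ, ENNReal.ofReal_toReal hβtop]
    congr 4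
    rw [hκ]; ring
  set V := (κ * a) ^ n * β with hV
  have hV0 : 0 < V := by positivity
  rw [hvol, ← ENNReal.ofReal_mul (by positivity), ← mul_assoc (ENNReal.ofReal V),
    ← ENNReal.ofReal_mul hV0.le, ← mul_assoc (ENNReal.ofReal (Λ * a)),
    ← ENNReal.ofReal_mul (by positivity)] at h
  set D := Λ * a * V with hD
  have hD0 : 0 < D := by positivity
  have h2 : ENNReal.ofReal D⁻¹ * (ENNReal.ofReal D * A) = A := by
    rw [← mul_assoc, ← ENNReal.ofReal_mul (by positivity), inv_mul_cancel₀ hD0.ne',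
      ENNReal.ofReal_one, one_mul]
  rw [← h2]
  refine (mul_le_mul_right h _).trans_eq ?_
  rw [mul_add, ← mul_assoc, ← mul_assoc, ← ENNReal.ofReal_mul (by positivity),
    ← ENNReal.ofReal_mul (by positivity)]
  congr 3
  · rw [hD]; field_simp
  · have hΛ0 : (0 : ℝ) ≤ 2 * Λ + 1 := by linarith
    rw [hD, hV, Real.mul_rpow hΛ0 ha.le, Real.rpow_add ha, Real.rpow_natCast, mul_pow]
    field_simp

/-- If the terms of a sequence satisfy `X (k + 1) ≤ X k / 2 + Y k` with `Y` summable, then `X` is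
summable. -/
lemma tsum_ne_top_of_le_half {X Y : ℕ → ENNReal} (h0 : X 0 ≠ ⊤)
    (h : ∀ k, X (k + 1) ≤ 2⁻¹ * X k + Y k) (hY : ∑' k, Y k ≠ ⊤) : ∑' k, X k ≠ ⊤ := by
  have key : ∀ N, ∑ k ∈ Finset.range N, X k + 2 * X N ≤
      2 * X 0 + 2 * ∑ k ∈ Finset.range N, Y k := by
    intro N
    induction N with
    | zero => simp
    | succ N ih =>
      have h1 : 2 * X (N + 1) ≤ X N + 2 * Y N := by
        refine (mul_le_mul_right (h N) 2).trans_eq ?_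
        rw [mul_add, ← mul_assoc, ENNReal.mul_inv_cancel two_ne_zero ENNReal.ofNat_ne_top, one_mul]
      rw [Finset.sum_range_succ, Finset.sum_range_succ, mul_add, ← add_assoc]
      calc _ ≤ ∑ k ∈ Finset.range N, X k + X N + (X N + 2 * Y N) := by gcongr
        _ = (∑ k ∈ Finset.range N, X k + 2 * X N) + 2 * Y N := by ring
        _ ≤ _ := by gcongr
  refine ne_top_of_le_ne_top (b := 2 * X 0 + 2 * ∑' k, Y k) (by finiteness) ?_
  refine ENNReal.tsum_le_of_sum_range_le fun N => (le_self_add.trans (key N)).trans ?_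
  gcongr
  exact ENNReal.sum_le_tsum _

/-- The weight `∫_{Ωᶜ} |x - y|^(-(n+s)) dy`, the total strength of the interaction of `x` with the
exterior of `Ω`. -/
noncomputable def exteriorWeight (s : ℝ) (Ω : Set (Eucl n)) (x : Eucl n) : ENNReal :=
  ∫⁻ y in Ωᶜ, ENNReal.ofReal (kernel s (x - y))

lemma exteriorWeight_le (hs : 0 < s) {Ω : Set (Eucl n)} {x : Eucl n} {δ : ℝ} (hδ : 0 < δ)
    (h : ∀ y ∈ Ωᶜ, δ ≤ ‖x - y‖) :
    exteriorWeight s Ω x ≤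
      ENNReal.ofReal (δ ^ (-s) * ∫ z in {z : Eucl n | 1 ≤ ‖z‖}, kernel s z) := by
  rw [← lintegral_kernel_far hs hδ x]
  exact lintegral_mono_set h

/-- A ratio of scales for which the comparison of layers can be absorbed. -/
lemma exists_scale_ratio (hs1 : s < 1) : ∃ Λ : ℝ, 3 ≤ Λ ∧ (3 * Λ) ^ s * (1 / Λ) ≤ 1 / 2 := by
  have h : Filter.Tendsto (fun Λ : ℝ => 3 ^ s * Λ ^ (-(1 - s))) Filter.atTop (nhds (3 ^ s * 0)) :=
    (tendsto_rpow_neg_atTop (by linarith)).const_mul _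
  rw [mul_zero] at h
  obtain ⟨Λ, h1, h2⟩ := ((h.eventually (ge_mem_nhds (show (0 : ℝ) < 1 / 2 by norm_num))).and
    (Filter.eventually_ge_atTop 3)).exists
  refine ⟨Λ, h2, ?_⟩
  have hΛ : 0 < Λ := by linarith
  rw [Real.mul_rpow (by norm_num) hΛ.le]
  refine le_of_eq_of_le ?_ h1
  rw [neg_sub, Real.rpow_sub hΛ, Real.rpow_one]
  ring

lemma pairwise_disjoint_annularPairs (Ω : Set (Eucl n)) {Λ a₀ : ℝ} (hΛ : 3 ≤ Λ) (ha₀ : 0 < a₀) :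
    Pairwise (Function.onFun Disjoint fun k : ℕ => annularPairs Ω Λ (a₀ * (3 * Λ)⁻¹ ^ k)) := by
  refine (pairwise_disjoint_on _).2 fun j k hjk => Set.disjoint_left.2 fun p hp hp' => ?_
  have h1 := hp.2.1
  have h2 := hp'.2.2
  have hq : (3 * Λ)⁻¹ ^ k ≤ (3 * Λ)⁻¹ ^ (j + 1) := by
    refine pow_le_pow_of_le_one (by positivity) ?_ hjk
    exact inv_le_one_of_one_le₀ (by linarith)
  have h3 : (2 * Λ + 1) * (a₀ * (3 * Λ)⁻¹ ^ k) ≤ (Λ - 1) * (a₀ * (3 * Λ)⁻¹ ^ j) := by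
    calc (2 * Λ + 1) * (a₀ * (3 * Λ)⁻¹ ^ k) ≤ (2 * Λ + 1) * (a₀ * (3 * Λ)⁻¹ ^ (j + 1)) := by gcongr
      _ = ((2 * Λ + 1) * (3 * Λ)⁻¹) * (a₀ * (3 * Λ)⁻¹ ^ j) := by ring
      _ ≤ _ := by
        gcongr
        rw [← div_eq_mul_inv, div_le_iff₀ (by linarith)]
        nlinarith
  linarith

lemma tsum_annularPairs_ne_top {Ω : Set (Eucl n)} (hΩ : MeasurableSet Ω) {u : Eucl n → ℝ}
    (hu : Measurable u) (hgag : gagliardo s u Ω ≠ ⊤) {Λ a₀ : ℝ} (hΛ : 3 ≤ Λ) (ha₀ : 0 < a₀) :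
    ∑' k : ℕ, ∫⁻ p in annularPairs Ω Λ (a₀ * (3 * Λ)⁻¹ ^ k), gagliardoIntegrand s u p ≠ ⊤ := by
  rw [← lintegral_iUnion (fun k => measurableSet_annularPairs hΩ _ _)
    (pairwise_disjoint_annularPairs Ω hΛ ha₀)]
  refine ne_top_of_le_ne_top hgag ?_
  rw [gagliardo_eq_prod hu]
  exact lintegral_mono_set (Set.iUnion_subset fun k => Set.inter_subset_left)

/-- The fractional Hardy inequality near a boundary point at which `Ω` is the region above a
graph: the layers at heights `a₀ (3 Λ)^(-k)` are compared with each other, weighted and summed. -/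
lemma local_hardy {t : Eucl n → ℝ} {e x₀ : Eucl n} {L : NNReal} (ht : LipschitzWith L t)
    (he : ‖e‖ = 1) (hte : ∀ z τ, t (z + τ • e) = t z + τ) (hs : 0 < s) (hs1 : s < 1)
    {Ω : Set (Eucl n)} (hΩ : MeasurableSet Ω) {r : ℝ} (hr : 0 < r)
    (htΩ : ∀ y ∈ Metric.ball x₀ r, y ∈ Ω ↔ 0 < t y) {u : Eucl n → ℝ} (hu : Measurable u)
    (huint : ∫⁻ x in Ω, ‖u x‖ₑ ≠ ⊤) (hgag : gagliardo s u Ω ≠ ⊤) :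
    ∫⁻ x in Ω ∩ Metric.ball x₀ (r / 2), ‖u x‖ₑ * exteriorWeight s Ω x < ⊤ := by
  obtain ⟨Λ, hΛ, hΛs⟩ := exists_scale_ratio hs1
  obtain ⟨C, hC, hcomp⟩ := layer_comparison (x₀ := x₀) ht he hte hΛ hs hΩ hu
  have hL : (0 : ℝ) ≤ L := L.2
  have hq : 0 < 3 * Λ := by linarith
  set a : ℕ → ℝ := fun k => r / 2 * (3 * Λ)⁻¹ ^ k with ha
  have ha0 : ∀ k, 0 < a k := fun k => by positivity
  have hasucc : ∀ k, 3 * Λ * a (k + 1) = a k := fun k => by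
    simp only [ha]; rw [pow_succ]; field_simp
  have hale : ∀ k, a k ≤ r / 2 := fun k => by
    refine mul_le_of_le_one_right (by linarith) (pow_le_one₀ (by positivity) ?_)
    exact inv_le_one_of_one_le₀ (by linarith)
  have hsubΩ : ∀ k, layer t x₀ (r / 2 + a k) (a k) ⊆ Ω := fun k x hx =>
    (htΩ x (Metric.ball_subset_ball (by linarith [hale k]) hx.1)).2 hx.2.1
  set A : ℕ → ENNReal := fun k => ∫⁻ x in layer t x₀ (r / 2 + a k) (a k), ‖u x‖ₑ with hA
  set E : ℕ → ENNReal := fun k => ∫⁻ p in annularPairs Ω Λ (a k), gagliardoIntegrand s u p with hE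
  have hEsum : ∑' k, E k ≠ ⊤ := tsum_annularPairs_ne_top hΩ hu hgag hΛ (by positivity)
  -- the weighted layer integrals are summable, by comparison of consecutive layers
  have hsum : ∑' k, ENNReal.ofReal (a k ^ (-s)) * A k ≠ ⊤ := by
    refine tsum_ne_top_of_le_half (Y := fun k => ENNReal.ofReal C * E (k + 1)) ?_ (fun k => ?_) ?_
    · refine ENNReal.mul_ne_top ENNReal.ofReal_ne_top (ne_top_of_le_ne_top huint ?_)
      exact lintegral_mono_set (hsubΩ 0)
    · have h := hcomp (a (k + 1)) (r / 2) (ha0 _) (by rw [hasucc]; exact hsubΩ k)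
      rw [hasucc] at h
      refine (mul_le_mul_right h _).trans ?_
      rw [mul_add, ← mul_assoc, ← mul_assoc, ← ENNReal.ofReal_mul (by positivity),
        ← ENNReal.ofReal_mul (by positivity)]
      refine add_le_add ?_ (le_of_eq ?_)
      · rw [← mul_assoc]
        refine mul_le_mul_left ?_ _
        rw [← ENNReal.ofReal_ofNat, ← ENNReal.ofReal_inv_of_pos two_pos,
          ← ENNReal.ofReal_mul (by norm_num)]
        refine ENNReal.ofReal_le_ofReal ?_
        have h1 : a (k + 1) ^ (-s) = (3 * Λ) ^ s * a k ^ (-s) := by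
          rw [← hasucc k, Real.mul_rpow hq.le (ha0 _).le, ← mul_assoc, ← Real.rpow_add hq]
          simp
        rw [h1]
        nlinarith [Real.rpow_pos_of_pos (ha0 k) (-s)]
      · congr 2
        rw [mul_left_comm, ← Real.rpow_add (ha0 _)]
        simp
    · rw [ENNReal.tsum_mul_left]
      refine ENNReal.mul_ne_top ENNReal.ofReal_ne_top (ne_top_of_le_ne_top hEsum ?_)
      exact ENNReal.tsum_comp_le_tsum_of_injective (add_left_injective 1) E
  set C₀ := ∫ z in {z : Eucl n | 1 ≤ ‖z‖}, kernel s z with hC₀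
  have hC₀' : 0 ≤ C₀ := integral_nonneg kernel_nonneg
  have hweight : ∀ x ∈ Metric.ball x₀ (r / 2), ∀ b, 0 < b → b ≤ r / 2 → b ≤ t x →
      exteriorWeight s Ω x ≤ ENNReal.ofReal ((b / (L + 1)) ^ (-s) * C₀) := by
    intro x hx b hb hbr hbt
    refine exteriorWeight_le hs (by positivity) fun y hy => ?_
    rw [div_le_iff₀ (by positivity)]
    by_cases hyr : y ∈ Metric.ball x₀ r
    · have h1 : t y ≤ 0 := not_lt.1 fun h => hy ((htΩ y hyr).2 h)
      have h2 := ht.dist_le_mul x y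
      rw [Real.dist_eq, dist_eq_norm] at h2
      have := le_abs_self (t x - t y)
      nlinarith [norm_nonneg (x - y)]
    · rw [mem_ball_iff_norm] at hx hyr
      have h1 := norm_sub_le_norm_sub_add_norm_sub y x x₀
      rw [norm_sub_rev y x] at h1
      nlinarith [norm_nonneg (x - y)]
  set c₁ := ENNReal.ofReal ((a 0 / (L + 1)) ^ (-s) * C₀) with hc₁
  set c₂ := ENNReal.ofReal (((3 * Λ) * (L + 1)) ^ s * C₀) with hc₂
  -- the weight is controlled by the layers: `x` at height between `a (k + 1)` and `a k` has
  -- distance at least `a (k + 1) / (L + 1)` to the exterior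
  have hpt : ∀ x ∈ Ω ∩ Metric.ball x₀ (r / 2), ‖u x‖ₑ * exteriorWeight s Ω x ≤ c₁ * ‖u x‖ₑ +
      ∑' k, c₂ * (ENNReal.ofReal (a k ^ (-s)) *
        (layer t x₀ (r / 2 + a k) (a k)).indicator (fun x => ‖u x‖ₑ) x) := by
    intro x hx
    have hxr := Metric.ball_subset_ball (half_le_self hr.le) hx.2
    have htx := (htΩ x hxr).1 hx.1
    rcases le_or_gt (a 0) (t x) with h | h
    · rw [mul_comm]
      exact (mul_le_mul_left (hweight x hx.2 _ (ha0 0) (hale 0) h) _).trans le_self_add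
    · obtain ⟨k, hk1, hk2⟩ := exists_nat_pow_near_of_lt_one (x := t x / (r / 2)) (y := (3 * Λ)⁻¹)
        (by positivity) (by rw [div_le_one (by positivity)]; simpa [ha] using h.le) (by positivity)
        (inv_lt_one_of_one_lt₀ (by linarith))
      rw [lt_div_iff₀ (by positivity), mul_comm] at hk1
      rw [div_le_iff₀ (by positivity), mul_comm] at hk2
      have hmem : x ∈ layer t x₀ (r / 2 + a k) (a k) :=
        ⟨Metric.ball_subset_ball (by linarith [ha0 k]) hx.2, htx, hk2⟩
      have hw := hweight x hx.2 (a (k + 1)) (ha0 _) (hale _) hk1.le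
      refine le_trans ?_ (le_add_left (ENNReal.le_tsum k))
      rw [Set.indicator_of_mem hmem, ← mul_assoc, hc₂, mul_comm]
      refine mul_le_mul_left (hw.trans_eq ?_) _
      rw [← ENNReal.ofReal_mul (by positivity)]
      congr 1
      have h1 : a (k + 1) / (L + 1) = a k * (3 * Λ * (L + 1))⁻¹ := by
        rw [← hasucc k]; field_simp
      rw [h1, Real.mul_rpow (ha0 k).le (by positivity), Real.inv_rpow (by positivity),
        Real.rpow_neg (ha0 k).le, Real.rpow_neg (by positivity) s, inv_inv]
      ring
  have hUm : ∀ k, MeasurableSet (layer t x₀ (r / 2 + a k) (a k)) := fun k =>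
    measurableSet_layer ht.continuous _ _ _
  refine (setLIntegral_mono' (hΩ.inter Metric.isOpen_ball.measurableSet) hpt).trans_lt ?_
  rw [lintegral_add_left (hu.enorm.const_mul _), lintegral_const_mul _ hu.enorm,
    lintegral_tsum fun k => (((hu.enorm.indicator (hUm k)).const_mul _).const_mul _).aemeasurable]
  refine ENNReal.add_lt_top.2 ⟨ENNReal.mul_lt_top ENNReal.ofReal_lt_top ?_, ?_⟩
  · exact (lintegral_mono_set Set.inter_subset_left).trans_lt huint.lt_top
  · have hterm : ∀ k, ∫⁻ x in Ω ∩ Metric.ball x₀ (r / 2), c₂ * (ENNReal.ofReal (a k ^ (-s)) *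
        (layer t x₀ (r / 2 + a k) (a k)).indicator (fun x => ‖u x‖ₑ) x) ≤
        c₂ * (ENNReal.ofReal (a k ^ (-s)) * A k) := fun k => by
      rw [lintegral_const_mul _ ((hu.enorm.indicator (hUm k)).const_mul _),
        lintegral_const_mul _ (hu.enorm.indicator (hUm k))]
      gcongr
      exact (setLIntegral_le_lintegral _ _).trans_eq (lintegral_indicator (hUm k) _)
    refine (ENNReal.tsum_le_tsum hterm).trans_lt ?_
    rw [ENNReal.tsum_mul_left]
    exact ENNReal.mul_lt_top ENNReal.ofReal_lt_top hsum.lt_top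

/-! ### The fractional Hardy inequality and integrability of energy differences -/

/-- Near a boundary point, a set with Lipschitz boundary is the set where the vertical height above
a graph is positive. The height is a Lipschitz function on the whole space. -/
lemma HasLipschitzBoundary.exists_height {Ω : Set (Eucl n)} (h : HasLipschitzBoundary Ω)
    {x₀ : Eucl n} (hx₀ : x₀ ∈ frontier Ω) :
    ∃ (e : Eucl n) (t : Eucl n → ℝ) (L : NNReal) (r : ℝ), ‖e‖ = 1 ∧ LipschitzWith L t ∧
      (∀ z τ, t (z + τ • e) = t z + τ) ∧ 0 < r ∧ ∀ y ∈ Metric.ball x₀ r, y ∈ Ω ↔ 0 < t y := by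
  obtain ⟨e, γ, K, r, he, hγ, hr, hΩ⟩ := h x₀ hx₀
  have hee : inner ℝ e e = (1 : ℝ) := by rw [real_inner_self_eq_norm_sq, he, one_pow]
  have hin : LipschitzWith 1 fun z : Eucl n => (inner ℝ e z : ℝ) := by
    refine LipschitzWith.of_dist_le_mul fun x y => ?_
    rw [Real.dist_eq, ← inner_sub_right, dist_eq_norm, NNReal.coe_one]
    simpa [he] using abs_real_inner_le_norm e (x - y)
  have hproj : LipschitzWith 2 fun z : Eucl n => z - (inner ℝ e z : ℝ) • e := by
    have h2 : LipschitzWith 1 fun z : Eucl n => (inner ℝ e z : ℝ) • e := by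
      refine LipschitzWith.of_dist_le_mul fun x y => ?_
      rw [dist_eq_norm, ← sub_smul, norm_smul, he, mul_one, ← dist_eq_norm]
      exact hin.dist_le_mul x y
    have := LipschitzWith.id.sub h2
    rwa [one_add_one_eq_two] at this
  refine ⟨e, fun z => inner ℝ e z - γ (z - (inner ℝ e z : ℝ) • e), 1 + K * 2, r, he,
    hin.sub (hγ.comp hproj), fun z τ => ?_, hr, fun y hy => by rw [hΩ y hy, sub_pos]⟩
  have h1 : (inner ℝ e (z + τ • e) : ℝ) = inner ℝ e z + τ := by
    rw [inner_add_right, inner_smul_right, hee, mul_one]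
  simp only [h1]
  rw [show z + τ • e - (inner ℝ e z + τ : ℝ) • e = z - (inner ℝ e z : ℝ) • e by
    rw [add_smul]; abel]
  ring

lemma gagliardo_congr_ae {u v : Eucl n → ℝ} {Ω : Set (Eucl n)} (h : u =ᵐ[volume.restrict Ω] v) :
    gagliardo s u Ω = gagliardo s v Ω := by
  refine lintegral_congr_ae ?_
  filter_upwards [h] with x hx
  refine lintegral_congr_ae ?_
  filter_upwards [h] with y hy
  rw [hx, hy]

/-- The fractional Hardy inequality in its qualitative form: on a bounded set with Lipschitz
boundary, a function in `W^{s,1}` is integrable against the weight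
`x ↦ ∫_{Ωᶜ} |x - y|^(-(n+s)) dy`. Compactness of the closure reduces it to neighbourhoods of single
points. -/
theorem fractional_hardy (hs : 0 < s) (hs1 : s < 1) {Ω : Set (Eucl n)} (hΩ : IsOpen Ω)
    (hb : Bornology.IsBounded Ω) (hLip : HasLipschitzBoundary Ω) {u : Eucl n → ℝ}
    (hu : u ∈ W s Ω) : ∫⁻ x in Ω, ‖u x‖ₑ * exteriorWeight s Ω x < ⊤ := by
  obtain ⟨v, hv, huv⟩ := hu.1.aestronglyMeasurable.aemeasurable
  have hvint : ∫⁻ x in Ω, ‖v x‖ₑ ≠ ⊤ := by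
    refine ne_of_eq_of_ne (lintegral_congr_ae ?_) hu.1.2.ne
    filter_upwards [huv] with x hx
    rw [hx]
  have hvgag : gagliardo s v Ω ≠ ⊤ := by
    rw [← gagliardo_congr_ae huv]; exact hu.2.ne
  have hcongr : ∫⁻ x in Ω, ‖u x‖ₑ * exteriorWeight s Ω x =
      ∫⁻ x in Ω, ‖v x‖ₑ * exteriorWeight s Ω x := by
    refine lintegral_congr_ae ?_
    filter_upwards [huv] with x hx
    rw [hx]
  rw [hcongr]
  have hcpt : IsCompact (closure Ω) := hb.isCompact_closure
  have key : ∫⁻ x in Ω ∩ closure Ω, ‖v x‖ₑ * exteriorWeight s Ω x < ⊤ := by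
    refine hcpt.induction_on (p := fun S => ∫⁻ x in Ω ∩ S, ‖v x‖ₑ * exteriorWeight s Ω x < ⊤)
      (by simp) (fun S T hST hT => ?_) (fun S T hS hT => ?_) (fun x hx => ?_)
    · exact (lintegral_mono_set (Set.inter_subset_inter_right _ hST)).trans_lt hT
    · rw [Set.inter_union_distrib_left]
      exact (lintegral_union_le _ _ _).trans_lt (ENNReal.add_lt_top.2 ⟨hS, hT⟩)
    · by_cases hxΩ : x ∈ Ω
      · obtain ⟨r, hr, hball⟩ := Metric.isOpen_iff.1 hΩ x hxΩ
        refine ⟨Metric.ball x (r / 2), mem_nhdsWithin_of_mem_nhds (Metric.ball_mem_nhds _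
          (half_pos hr)), ?_⟩
        have hle : ∀ z ∈ Ω ∩ Metric.ball x (r / 2), ‖v z‖ₑ * exteriorWeight s Ω z ≤ ‖v z‖ₑ *
            ENNReal.ofReal ((r / 2) ^ (-s) * ∫ z in {z : Eucl n | 1 ≤ ‖z‖}, kernel s z) := by
          intro z hz
          gcongr
          refine exteriorWeight_le hs (half_pos hr) fun y hy => ?_
          by_contra! hlt
          refine hy (hball ?_)
          have hz2 := mem_ball_iff_norm.1 hz.2
          rw [mem_ball_iff_norm]
          have h1 := norm_sub_le_norm_sub_add_norm_sub y z x
          rw [norm_sub_rev y z] at h1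
          linarith
        refine (setLIntegral_mono' (hΩ.inter Metric.isOpen_ball).measurableSet hle).trans_lt ?_
        rw [lintegral_mul_const _ hv.enorm]
        exact ENNReal.mul_lt_top ((lintegral_mono_set Set.inter_subset_left).trans_lt hvint.lt_top)
          ENNReal.ofReal_lt_top
      · have hxf : x ∈ frontier Ω := by
          rw [hΩ.frontier_eq]; exact ⟨hx, hxΩ⟩
        obtain ⟨e, t, L, r, he, ht, hte, hr, htΩ⟩ := hLip.exists_height hxf
        exact ⟨Metric.ball x (r / 2), mem_nhdsWithin_of_mem_nhds (Metric.ball_mem_nhds _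
          (half_pos hr)), local_hardy ht he hte hs hs1 hΩ.measurableSet hr htΩ hv hvint hvgag⟩
  rwa [Set.inter_eq_left.2 subset_closure] at key

lemma aemeasurable_gagliardoIntegrand {μ : Measure (Eucl n)} [SFinite μ] {u : Eucl n → ℝ}
    (hu : AEMeasurable u μ) : AEMeasurable (gagliardoIntegrand s u) (μ.prod μ) := by
  have h1 : AEMeasurable (fun p : Eucl n × Eucl n => u p.1 - u p.2) (μ.prod μ) :=
    hu.comp_fst.sub hu.comp_snd
  have h2 : Measurable fun p : Eucl n × Eucl n => kernel s (p.1 - p.2) :=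
    measurable_kernel.comp (by fun_prop)
  have h3 : AEMeasurable (fun p : Eucl n × Eucl n => |u p.1 - u p.2|) (μ.prod μ) :=
    continuous_abs.measurable.comp_aemeasurable h1
  exact (h3.mul h2.aemeasurable).ennreal_ofReal

lemma gagliardo_eq_prod_of_aemeasurable {u : Eucl n → ℝ} {Ω : Set (Eucl n)}
    (hu : AEMeasurable u (volume.restrict Ω)) :
    gagliardo s u Ω = ∫⁻ p in Ω ×ˢ Ω, gagliardoIntegrand s u p := by
  rw [gagliardo_eq, Measure.volume_eq_prod, ← Measure.prod_restrict,
    lintegral_prod _ (aemeasurable_gagliardoIntegrand hu)]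

lemma Q_eq (Ω : Set (Eucl n)) : Q Ω = Ω ×ˢ Ω ∪ (Ω ×ˢ Ωᶜ ∪ Ωᶜ ×ˢ Ω) := by
  ext ⟨x, y⟩
  simp only [Q, Set.mem_compl_iff, Set.mem_prod, Set.mem_union]
  tauto

lemma measurableSet_Q {Ω : Set (Eucl n)} (hΩ : MeasurableSet Ω) : MeasurableSet (Q Ω) :=
  (hΩ.compl.prod hΩ.compl).compl

lemma lintegral_exterior_eq {d : Eucl n → ℝ} (hd : AEMeasurable d) {Ω : Set (Eucl n)}
    (hΩ : MeasurableSet Ω) (hd0 : ∀ x ∈ Ωᶜ, d x = 0) :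
    ∫⁻ p in Ω ×ˢ Ωᶜ, gagliardoIntegrand s d p = ∫⁻ x in Ω, ‖d x‖ₑ * exteriorWeight s Ω x ∧
    ∫⁻ p in Ωᶜ ×ˢ Ω, gagliardoIntegrand s d p = ∫⁻ x in Ω, ‖d x‖ₑ * exteriorWeight s Ω x := by
  have hm := aemeasurable_gagliardoIntegrand (s := s) hd
  have hk : ∀ x : Eucl n, Measurable fun y => ENNReal.ofReal (kernel s (x - y)) := fun x =>
    (measurable_kernel.comp (by fun_prop)).ennreal_ofReal
  rw [Measure.volume_eq_prod]
  constructor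
  · rw [← Measure.prod_restrict, lintegral_prod]
    · refine lintegral_congr fun x => ?_
      rw [exteriorWeight, ← lintegral_const_mul _ (hk x)]
      refine setLIntegral_congr_fun hΩ.compl fun y hy => ?_
      simp only [gagliardoIntegrand, hd0 y hy, sub_zero]
      rw [ENNReal.ofReal_mul (abs_nonneg _), Real.enorm_eq_ofReal_abs]
    · rw [Measure.prod_restrict]; exact hm.restrict
  · rw [← Measure.prod_restrict, lintegral_prod_symm]
    · refine lintegral_congr fun x => ?_
      rw [exteriorWeight, ← lintegral_const_mul _ (hk x)]
      refine setLIntegral_congr_fun hΩ.compl fun y hy => ?_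
      simp only [gagliardoIntegrand, hd0 y hy, zero_sub, abs_neg]
      rw [ENNReal.ofReal_mul (abs_nonneg _), Real.enorm_eq_ofReal_abs, ← kernel_neg, neg_sub]
    · rw [Measure.prod_restrict]; exact hm.restrict

/-- For a function of `W^{s,1}(Ω)` extended by zero, the Gagliardo integral over all of `Q(Ω)`, and
not only over `Ω × Ω`, is finite. -/
lemma lintegral_Q_gagliardoIntegrand_lt_top (hs : 0 < s) (hs1 : s < 1) {Ω : Set (Eucl n)}
    (hΩ : IsOpen Ω) (hb : Bornology.IsBounded Ω) (hLip : HasLipschitzBoundary Ω) {d : Eucl n → ℝ}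
    (hd : d ∈ W s Ω) (hdm : AEMeasurable d) (hd0 : ∀ x ∈ Ωᶜ, d x = 0) :
    ∫⁻ p in Q Ω, gagliardoIntegrand s d p < ⊤ := by
  have h := fractional_hardy hs hs1 hΩ hb hLip hd
  obtain ⟨h1, h2⟩ := lintegral_exterior_eq (s := s) hdm hΩ.measurableSet hd0
  rw [Q_eq]
  refine (lintegral_union_le _ _ _).trans_lt (ENNReal.add_lt_top.2 ⟨?_, ?_⟩)
  · rw [← gagliardo_eq_prod_of_aemeasurable hdm.restrict]; exact hd.2
  · refine (lintegral_union_le _ _ _).trans_lt (ENNReal.add_lt_top.2 ⟨?_, ?_⟩)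
    · rwa [h1]
    · rwa [h2]

lemma aemeasurable_areaIntegrand {u : Eucl n → ℝ} (hu : AEMeasurable u) :
    AEMeasurable (areaIntegrand n s u) := by
  have h1 : AEMeasurable (fun p : Eucl n × Eucl n => u p.1 - u p.2) :=
    (AEMeasurable.comp_fst hu).sub (AEMeasurable.comp_snd hu)
  have h2 : Measurable fun p : Eucl n × Eucl n => ‖p.1 - p.2‖ := by fun_prop
  exact ((continuous_scriptG n s).measurable.comp_aemeasurable (h1.div h2.aemeasurable)).div
    (h2.pow_const _).aemeasurable

/-- A function whose differences are dominated by those of two members of `W^{s,1}(Ω)` is a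
member. -/
lemma W_of_abs_sub_le {Ω : Set (Eucl n)} (hΩ : MeasurableSet Ω) {u v w : Eucl n → ℝ}
    (hu : u ∈ W s Ω) (hv : v ∈ W s Ω) (hw : IntegrableOn w Ω)
    (h : ∀ x ∈ Ω, ∀ y ∈ Ω, |w x - w y| ≤ |u x - u y| + |v x - v y|) : w ∈ W s Ω := by
  have hum := hu.1.aestronglyMeasurable.aemeasurable
  have hvm := hv.1.aestronglyMeasurable.aemeasurable
  have hwm := hw.aestronglyMeasurable.aemeasurable
  refine ⟨hw, ?_⟩
  have hu2 := hu.2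
  have hv2 := hv.2
  rw [gagliardo_eq_prod_of_aemeasurable hum] at hu2
  rw [gagliardo_eq_prod_of_aemeasurable hvm] at hv2
  rw [gagliardo_eq_prod_of_aemeasurable hwm]
  refine lt_of_le_of_lt (setLIntegral_mono' (hΩ.prod hΩ) (g := fun p =>
    gagliardoIntegrand s u p + gagliardoIntegrand s v p) fun p hp => ?_) ?_
  · rw [gagliardoIntegrand, gagliardoIntegrand, gagliardoIntegrand,
      ← ENNReal.ofReal_add (mul_nonneg (abs_nonneg _) (kernel_nonneg _))
        (mul_nonneg (abs_nonneg _) (kernel_nonneg _)), ← add_mul]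
    exact ENNReal.ofReal_le_ofReal (mul_le_mul_of_nonneg_right (h _ hp.1 _ hp.2) (kernel_nonneg _))
  · rw [lintegral_add_left']
    · exact ENNReal.add_lt_top.2 ⟨hu2, hv2⟩
    · rw [Measure.volume_eq_prod, ← Measure.prod_restrict]
      exact aemeasurable_gagliardoIntegrand hum

lemma W_sub {Ω : Set (Eucl n)} (hΩ : MeasurableSet Ω) {u v : Eucl n → ℝ}
    (hu : u ∈ W s Ω) (hv : v ∈ W s Ω) : (fun x => u x - v x) ∈ W s Ω := by
  refine W_of_abs_sub_le hΩ hu hv (hu.1.sub hv.1) fun x _ y _ => ?_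
  rw [show u x - v x - (u y - v y) = (u x - u y) - (v x - v y) by ring]
  exact abs_sub _ _

lemma aemeasurable_of_mem_WExt {Ω : Set (Eucl n)} (hΩ : MeasurableSet Ω) {φ u : Eucl n → ℝ}
    (hφ : AEMeasurable φ (volume.restrict Ωᶜ)) (hu : u ∈ WExt s Ω φ) : AEMeasurable u := by
  have h1 := hu.1.1.aestronglyMeasurable.aemeasurable
  have h2 : AEMeasurable u (volume.restrict Ωᶜ) :=
    hφ.congr ((ae_restrict_iff' hΩ.compl).2 (Filter.Eventually.of_forall fun x hx =>
      (hu.2 x hx).symm))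
  have := aemeasurable_union_iff.2 ⟨h1, h2⟩
  rwa [Set.union_compl_self, Measure.restrict_univ] at this

lemma abs_areaIntegrand_sub_le (hn : 1 ≤ n) (hs : 0 < s) (u v : Eucl n → ℝ) (p : Eucl n × Eucl n) :
    |areaIntegrand n s u p - areaIntegrand n s v p| ≤
      2 * (|(u p.1 - v p.1) - (u p.2 - v p.2)| * kernel s (p.1 - p.2)) := by
  rw [areaIntegrand_eq, areaIntegrand_eq]
  refine (pairEnergy_sub_le hn hs (norm_nonneg _) _ _).trans_eq ?_
  rw [div_eq_mul_inv, kernel]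
  congr 3
  ring

/-- The energies of two functions with the same exterior data may be infinite, but their
integrands differ by an integrable function. -/
theorem integrableOn_areaIntegrand_sub (hn : 1 ≤ n) (hs : 0 < s) (hs1 : s < 1)
    {Ω : Set (Eucl n)} (hΩ : IsOpen Ω) (hb : Bornology.IsBounded Ω)
    (hLip : HasLipschitzBoundary Ω) {φ u v : Eucl n → ℝ}
    (hφ : AEMeasurable φ (volume.restrict Ωᶜ)) (hu : u ∈ WExt s Ω φ) (hv : v ∈ WExt s Ω φ) :
    IntegrableOn (fun p => areaIntegrand n s u p - areaIntegrand n s v p) (Q Ω) := by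
  have hum := aemeasurable_of_mem_WExt hΩ.measurableSet hφ hu
  have hvm := aemeasurable_of_mem_WExt hΩ.measurableSet hφ hv
  refine ⟨((aemeasurable_areaIntegrand hum).sub
    (aemeasurable_areaIntegrand hvm)).aestronglyMeasurable.restrict, ?_⟩
  have hfin := lintegral_Q_gagliardoIntegrand_lt_top hs hs1 hΩ hb hLip
    (W_sub hΩ.measurableSet hu.1 hv.1) (hum.sub hvm)
    (fun x hx => by rw [hu.2 x hx, hv.2 x hx, sub_self])
  refine lt_of_le_of_lt (lintegral_mono (g := fun p =>
    ENNReal.ofReal 2 * gagliardoIntegrand s (fun x => u x - v x) p) fun p => ?_) ?_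
  · simp only [gagliardoIntegrand]
    rw [Real.enorm_eq_ofReal_abs, ← ENNReal.ofReal_mul zero_le_two]
    exact ENNReal.ofReal_le_ofReal (abs_areaIntegrand_sub_le hn hs u v p)
  · rw [lintegral_const_mul' _ _ ENNReal.ofReal_ne_top]
    exact ENNReal.mul_lt_top ENNReal.ofReal_lt_top hfin

/-! ### Truncation -/

/-- The truncation of a real number to `[-N, N]`. -/
def clamp (N a : ℝ) : ℝ := max (-N) (min a N)

lemma clamp_cases {N : ℝ} (hN : 0 ≤ N) (a : ℝ) :
    (N < a ∧ clamp N a = N) ∨ (a < -N ∧ clamp N a = -N) ∨ (|a| ≤ N ∧ clamp N a = a) := by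
  unfold clamp
  rcases lt_or_ge N a with h | h
  · exact Or.inl ⟨h, by rw [min_eq_right h.le, max_eq_right (by linarith)]⟩
  rcases lt_or_ge a (-N) with h' | h'
  · exact Or.inr (Or.inl ⟨h', by rw [min_eq_left h, max_eq_left h'.le]⟩)
  · exact Or.inr (Or.inr ⟨abs_le.2 ⟨h', h⟩, by rw [min_eq_left h, max_eq_right h']⟩)

lemma abs_clamp_le {N : ℝ} (hN : 0 ≤ N) (a : ℝ) : |clamp N a| ≤ N := by
  rcases clamp_cases hN a with ⟨_, h⟩ | ⟨_, h⟩ | ⟨h', h⟩ <;> rw [h]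
  · rw [abs_of_nonneg hN]
  · rw [abs_neg, abs_of_nonneg hN]
  · exact h'

lemma abs_clamp_sub_clamp_le (N a b : ℝ) : |clamp N a - clamp N b| ≤ |a - b| := by
  unfold clamp
  refine (abs_max_sub_max_le_max _ _ _ _).trans ?_
  rw [sub_self, abs_zero, max_eq_right (abs_nonneg _)]
  refine (abs_min_sub_min_le_max _ _ _ _).trans ?_
  rw [sub_self, abs_zero, max_eq_left (abs_nonneg _)]

lemma measurable_clamp (N : ℝ) : Measurable (clamp N) := by
  unfold clamp; fun_prop

lemma neg_le_pairEnergy_sub_clamp (hn : 1 ≤ n) (hs : 0 < s) {r : ℝ} (hr : 0 ≤ r) (N a b : ℝ) :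
    -(|a - clamp N a| * (2 * (r ^ ((n : ℝ) + s))⁻¹)) ≤
      pairEnergy n s r (a - b) - pairEnergy n s r (clamp N a - b) := by
  have h := (abs_le.1 (pairEnergy_sub_le hn hs hr (a - b) (clamp N a - b))).1
  rw [sub_sub_sub_cancel_right, div_eq_mul_inv] at h
  linarith

lemma pairEnergy_sub_clamp_nonneg {r : ℝ} (hr : 0 ≤ r) {D m : ℝ} (hD : 0 ≤ D) {b : ℝ}
    (hb : |b| ≤ m) (a : ℝ) :
    0 ≤ pairEnergy n s r (a - b) - pairEnergy n s r (clamp (D + m) a - b) := by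
  have hm : 0 ≤ m := (abs_nonneg b).trans hb
  rw [sub_nonneg]
  apply pairEnergy_mono_abs hr
  rw [abs_le] at hb
  rcases clamp_cases (add_nonneg hD hm) a with ⟨h', h⟩ | ⟨h', h⟩ | ⟨h', h⟩ <;> rw [h]
  · rw [abs_of_nonneg (by linarith), abs_of_nonneg (by linarith)]; linarith
  · rw [abs_of_nonpos (by linarith), abs_of_nonpos (by linarith)]; linarith

/-- The gain of energy by truncation at a height exceeding the exterior datum by `D`, for pairs of
points at distance at most `2 D`. -/
lemma le_pairEnergy_sub_clamp {r : ℝ} (hr : 0 < r) {D m : ℝ} (hrD : r ≤ 2 * D) {b : ℝ}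
    (hb : |b| ≤ m) (a : ℝ) :
    |a - clamp (D + m) a| * (G n s (1 / 2) * (r ^ ((n : ℝ) + s))⁻¹) ≤
      pairEnergy n s r (a - b) - pairEnergy n s r (clamp (D + m) a - b) := by
  have hm : 0 ≤ m := (abs_nonneg b).trans hb
  have hD : 0 ≤ D := by linarith
  rw [abs_le] at hb
  rcases clamp_cases (add_nonneg hD hm) a with ⟨h', h⟩ | ⟨h', h⟩ | ⟨h', h⟩ <;> rw [h]
  · have := pairEnergy_gain (n := n) (s := s) (r := r) (a := a - b) (b := D + m - b) hr
      (by linarith) (by linarith)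
    rw [abs_of_pos (by linarith)]
    refine le_of_eq_of_le ?_ this
    rw [div_eq_mul_inv]; ring
  · have := pairEnergy_gain (n := n) (s := s) (r := r) (a := b - a) (b := D + m + b) hr
      (by linarith) (by linarith)
    rw [← pairEnergy_neg _ _ _ (b - a), ← pairEnergy_neg _ _ _ (D + m + b)] at this
    rw [abs_of_neg (by linarith)]
    convert this using 1
    · rw [div_eq_mul_inv]; ring
    · congr 2 <;> ring
  · simp

open Classical in
/-- The function that is the truncation of `f` to `[-N, N]` inside `Ω` and equals `φ` outside. -/
noncomputable def truncate (Ω : Set (Eucl n)) (N : ℝ) (φ f : Eucl n → ℝ) : Eucl n → ℝ :=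
  Ω.piecewise (fun x => clamp N (f x)) φ

lemma truncate_of_mem {Ω : Set (Eucl n)} {x : Eucl n} (hx : x ∈ Ω) (N : ℝ) (φ f : Eucl n → ℝ) :
    truncate Ω N φ f x = clamp N (f x) := by
  simp [truncate, hx]

lemma truncate_of_notMem {Ω : Set (Eucl n)} {x : Eucl n} (hx : x ∈ Ωᶜ) (N : ℝ)
    (φ f : Eucl n → ℝ) : truncate Ω N φ f x = φ x := by
  have hx' : x ∉ Ω := hx
  simp [truncate, hx']

lemma truncate_mem_WExt {Ω : Set (Eucl n)} (hΩ : MeasurableSet Ω) (hb : Bornology.IsBounded Ω)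
    {N : ℝ} (hN : 0 ≤ N) {φ u : Eucl n → ℝ} (hu : u ∈ WExt s Ω φ) :
    truncate Ω N u u ∈ WExt s Ω φ := by
  refine ⟨W_of_abs_sub_le hΩ hu.1 hu.1 ?_ fun x hx y hy => ?_, fun x hx => ?_⟩
  · have h : IntegrableOn (fun x => clamp N (u x)) Ω := by
      refine IntegrableOn.of_bound hb.measure_lt_top ((measurable_clamp N).comp_aemeasurable
        hu.1.1.aestronglyMeasurable.aemeasurable).aestronglyMeasurable N
        (Filter.Eventually.of_forall fun x => abs_clamp_le hN _)
    exact h.congr_fun (fun x hx => (truncate_of_mem hx N u u).symm) hΩ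
  · rw [truncate_of_mem hx, truncate_of_mem hy]
    exact (abs_clamp_sub_clamp_le N _ _).trans (le_add_of_nonneg_right (abs_nonneg _))
  · rw [truncate_of_notMem hx, hu.2 x hx]

/-- The balance of gain and loss in the truncation: the gain from the pairs at distance between
`D` and `2 D` outweighs the possible loss from the pairs at distance at least `Θ D`. -/
noncomputable def balance (n : ℕ) (s D Θ : ℝ) (z : Eucl n) : ℝ :=
  {z : Eucl n | D < ‖z‖ ∧ ‖z‖ < 2 * D}.indicator (fun z => G n s (1 / 2) * kernel s z) z -
    {z : Eucl n | Θ * D ≤ ‖z‖}.indicator (fun z => 2 * kernel s z) z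

/-- The condition on `Θ` under which truncation does not increase the energy: the integral of
`balance` is nonnegative. Both sides scale like `D^(-s)`, so `D` does not occur. -/
def IsAdmissibleRatio (n : ℕ) (s Θ : ℝ) : Prop :=
  2 ≤ Θ ∧ 2 * (Θ ^ (-s) * ∫ z in {z : Eucl n | 1 ≤ ‖z‖}, kernel s z) ≤
    G n s (1 / 2) * ∫ z in {z : Eucl n | 1 < ‖z‖ ∧ ‖z‖ < 2}, kernel s z

lemma exists_isAdmissibleRatio (hn : 1 ≤ n) (hs : 0 < s) : ∃ Θ, IsAdmissibleRatio n s Θ := by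
  have hpos : 0 < G n s (1 / 2) * ∫ z in {z : Eucl n | 1 < ‖z‖ ∧ ‖z‖ < 2}, kernel s z :=
    mul_pos (by simpa using strictMono_G n s (show (0 : ℝ) < 1 / 2 by norm_num))
      (setIntegral_kernel_annulus_pos hn hs)
  have h : Filter.Tendsto (fun Θ : ℝ => 2 * (Θ ^ (-s) *
      ∫ z in {z : Eucl n | 1 ≤ ‖z‖}, kernel s z)) Filter.atTop (nhds (2 * (0 * _))) :=
    ((tendsto_rpow_neg_atTop hs).mul_const _).const_mul _
  rw [zero_mul, mul_zero] at h
  obtain ⟨Θ, h1, h2⟩ := ((h.eventually (ge_mem_nhds hpos)).and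
    (Filter.eventually_ge_atTop 2)).exists
  exact ⟨Θ, h2, h1⟩

lemma measurableSet_annulus (D : ℝ) : MeasurableSet {z : Eucl n | D < ‖z‖ ∧ ‖z‖ < 2 * D} :=
  (measurableSet_lt measurable_const measurable_norm).inter
    (measurableSet_lt measurable_norm measurable_const)

lemma measurableSet_far (R : ℝ) : MeasurableSet {z : Eucl n | R ≤ ‖z‖} :=
  measurableSet_le measurable_const measurable_norm

lemma integrable_balance (hs : 0 < s) {D Θ : ℝ} (hD : 0 < D) (hΘ : 0 < Θ) :
    Integrable (balance n s D Θ) := by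
  refine Integrable.sub ?_ ?_
  · refine (integrable_indicator_iff (measurableSet_annulus D)).2 (Integrable.const_mul ?_ _)
    exact (integrableOn_kernel hs hD).mono_set fun z hz => hz.1.le
  · refine (integrable_indicator_iff (measurableSet_far _)).2 (Integrable.const_mul ?_ _)
    exact integrableOn_kernel hs (mul_pos hΘ hD)

lemma integral_balance_nonneg (hs : 0 < s) {D Θ : ℝ} (hD : 0 < D)
    (hΘ : IsAdmissibleRatio n s Θ) : 0 ≤ ∫ z, balance n s D Θ z := by
  obtain ⟨hΘ2, hΘ⟩ := hΘ
  have hΘ0 : 0 < Θ := by linarith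
  unfold balance
  rw [integral_sub, integral_indicator (measurableSet_annulus D),
    integral_indicator (measurableSet_far _), integral_const_mul, integral_const_mul,
    setIntegral_kernel_annulus hD, setIntegral_kernel_far (mul_pos hΘ0 hD),
    Real.mul_rpow hΘ0.le hD.le]
  · have := mul_le_mul_of_nonneg_left hΘ (Real.rpow_nonneg hD.le (-s))
    linarith
  · refine (integrable_indicator_iff (measurableSet_annulus D)).2 (Integrable.const_mul ?_ _)
    exact (integrableOn_kernel hs hD).mono_set fun z hz => hz.1.le
  · refine (integrable_indicator_iff (measurableSet_far _)).2 (Integrable.const_mul ?_ _)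
    exact integrableOn_kernel hs (mul_pos hΘ0 hD)

lemma mem_neighborhood_of_norm_lt {Ω : Set (Eucl n)} {x y : Eucl n} (hx : x ∈ Ω) {δ : ℝ}
    (h : ‖x - y‖ < δ) : y ∈ neighborhood Ω δ := by
  have h1 : Metric.infDist y Ω ≤ dist y x := Metric.infDist_le_dist_of_mem hx
  have h2 : 0 ≤ Metric.infDist y Ωᶜ := Metric.infDist_nonneg
  rw [dist_comm, dist_eq_norm] at h1
  change Metric.infDist y Ω - Metric.infDist y Ωᶜ < δ
  linarith

lemma measurableSet_neighborhood (Ω : Set (Eucl n)) (δ : ℝ) : MeasurableSet (neighborhood Ω δ) :=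
  measurableSet_lt ((Metric.continuous_infDist_pt Ω).sub
    (Metric.continuous_infDist_pt Ωᶜ)).measurable measurable_const

lemma diam_pos_of_mem (hn : 1 ≤ n) {Ω : Set (Eucl n)} (hΩ : IsOpen Ω)
    (hb : Bornology.IsBounded Ω) {x : Eucl n} (hx : x ∈ Ω) : 0 < Metric.diam Ω := by
  have : NeZero n := ⟨by omega⟩
  obtain ⟨r, hr, hball⟩ := Metric.isOpen_iff.1 hΩ x hx
  obtain ⟨z, hz⟩ := exists_norm_eq (Eucl n) (half_pos hr).le
  have hmem : x + z ∈ Ω := hball (by rw [mem_ball_iff_norm, add_sub_cancel_left, hz]; linarith)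
  have := Metric.dist_le_diam_of_mem hb hmem hx
  rw [dist_eq_norm, add_sub_cancel_left, hz] at this
  linarith

/-- The interaction of a point of `Ω` with the exterior does not increase under truncation. -/
lemma truncate_slice_nonneg (hn : 1 ≤ n) (hs : 0 < s) {Ω : Set (Eucl n)} (hΩ : IsOpen Ω)
    (hb : Bornology.IsBounded Ω) {Θ : ℝ} (hΘ : IsAdmissibleRatio n s Θ) {m : ℝ}
    {u : Eucl n → ℝ}
    (hm : ∀ᵐ y ∂volume.restrict (neighborhood Ω (Θ * Metric.diam Ω) \ Ω), |u y| ≤ m)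
    {x : Eucl n} (hx : x ∈ Ω) :
    0 ≤ ∫ y in Ωᶜ, (areaIntegrand n s u (x, y) -
      areaIntegrand n s (truncate Ω (Metric.diam Ω + m) u u) (x, y)) := by
  set D := Metric.diam Ω with hDdef
  have hD : 0 < D := diam_pos_of_mem hn hΩ hb hx
  have hΘ0 : 0 < Θ := by linarith [hΘ.1]
  set f : Eucl n → ℝ := fun y => areaIntegrand n s u (x, y) -
      areaIntegrand n s (truncate Ω (D + m) u u) (x, y) with hf
  set δ := |u x - clamp (D + m) (u x)| with hδ
  by_cases hint : IntegrableOn f Ωᶜ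
  swap
  -- the integral of a function that is not integrable is zero by convention
  · rw [integral_undef hint]
  have hbal : Integrable fun y => balance n s D Θ (x - y) :=
    (integrable_balance hs hD hΘ0).comp_sub_left x
  have hzero : ∀ y ∉ Ωᶜ, δ * balance n s D Θ (x - y) = 0 := by
    intro y hy
    have hle := Metric.dist_le_diam_of_mem hb hx (not_not.1 hy)
    rw [dist_eq_norm] at hle
    have hfar : x - y ∉ {z : Eucl n | Θ * D ≤ ‖z‖} := fun h => by
      have : Θ * D ≤ ‖x - y‖ := h
      nlinarith [hΘ.1]
    rw [balance, Set.indicator_of_notMem (fun h => absurd h.1 (not_lt.2 hle)),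
      Set.indicator_of_notMem hfar, sub_zero, mul_zero]
  have hstep : ∫ y in Ωᶜ, δ * balance n s D Θ (x - y) = δ * ∫ z, balance n s D Θ z := by
    rw [setIntegral_eq_integral_of_forall_compl_eq_zero hzero, integral_const_mul,
      integral_sub_left_eq_self (balance n s D Θ)]
  have h0 : 0 ≤ ∫ y in Ωᶜ, δ * balance n s D Θ (x - y) := by
    rw [hstep]
    exact mul_nonneg (abs_nonneg _) (integral_balance_nonneg hs hD hΘ)
  refine h0.trans (setIntegral_mono_on_ae (hbal.const_mul δ).integrableOn hint
    hΩ.measurableSet.compl ?_)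
  rw [ae_restrict_iff' ((measurableSet_neighborhood _ _).diff hΩ.measurableSet)] at hm
  filter_upwards [hm] with y hy hyΩ
  have hfy : f y = pairEnergy n s ‖x - y‖ (u x - u y) -
      pairEnergy n s ‖x - y‖ (clamp (D + m) (u x) - u y) := by
    simp only [hf, areaIntegrand_eq, truncate_of_mem hx, truncate_of_notMem hyΩ]
  refine le_of_le_of_eq ?_ hfy.symm
  rcases le_or_gt (Θ * D) ‖x - y‖ with hfar | hnear
  -- far from `x` nothing is known about the exterior datum
  · refine le_trans ?_ (neg_le_pairEnergy_sub_clamp hn hs (norm_nonneg (x - y)) (D + m) (u x) (u y))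
    have h1 : x - y ∈ {z : Eucl n | Θ * D ≤ ‖z‖} := hfar
    have h2 : x - y ∉ {z : Eucl n | D < ‖z‖ ∧ ‖z‖ < 2 * D} := fun h => by
      have := h.2
      nlinarith [hΘ.1]
    rw [balance, Set.indicator_of_notMem h2, Set.indicator_of_mem h1, zero_sub, mul_neg, kernel]
  · have h1 : x - y ∉ {z : Eucl n | Θ * D ≤ ‖z‖} := not_le.2 hnear
    have hbd := hy ⟨mem_neighborhood_of_norm_lt hx hnear, hyΩ⟩
    rw [balance, Set.indicator_of_notMem h1, sub_zero]
    by_cases h2 : x - y ∈ {z : Eucl n | D < ‖z‖ ∧ ‖z‖ < 2 * D}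
    · rw [Set.indicator_of_mem h2, kernel]
      exact le_pairEnergy_sub_clamp (hD.trans h2.1) h2.2.le hbd (u x)
    · rw [Set.indicator_of_notMem h2, mul_zero]
      exact pairEnergy_sub_clamp_nonneg (norm_nonneg _) hD.le hbd (u x)

lemma areaIntegrand_swap (u : Eucl n → ℝ) (p : Eucl n × Eucl n) :
    areaIntegrand n s u p.swap = areaIntegrand n s u p := by
  rw [areaIntegrand_eq, areaIntegrand_eq, Prod.fst_swap, Prod.snd_swap, norm_sub_rev,
    ← pairEnergy_neg, neg_sub]

/-- Truncation at the height `diam Ω + m`, where `m` bounds the exterior datum near `Ω`, does not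
increase the energy. -/
theorem integral_sub_truncate_nonneg (hn : 1 ≤ n) (hs : 0 < s) (hs1 : s < 1) {Ω : Set (Eucl n)}
    (hΩ : IsOpen Ω) (hb : Bornology.IsBounded Ω) (hLip : HasLipschitzBoundary Ω) {Θ : ℝ}
    (hΘ : IsAdmissibleRatio n s Θ) {m : ℝ} (hm0 : 0 ≤ m) {φ u : Eucl n → ℝ}
    (hφ : AEMeasurable φ (volume.restrict Ωᶜ))
    (hm : ∀ᵐ y ∂volume.restrict (neighborhood Ω (Θ * Metric.diam Ω) \ Ω), |φ y| ≤ m)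
    (hu : u ∈ WExt s Ω φ) :
    0 ≤ ∫ p in Q Ω, (areaIntegrand n s u p -
      areaIntegrand n s (truncate Ω (Metric.diam Ω + m) u u) p) := by
  have hN : 0 ≤ Metric.diam Ω + m := add_nonneg Metric.diam_nonneg hm0
  have hΩm := hΩ.measurableSet
  have hm' : ∀ᵐ y ∂volume.restrict (neighborhood Ω (Θ * Metric.diam Ω) \ Ω), |u y| ≤ m := by
    filter_upwards [hm, ae_restrict_mem ((measurableSet_neighborhood _ _).diff hΩm)] with y hy hyΩ
    rwa [hu.2 y hyΩ.2]
  have hint := integrableOn_areaIntegrand_sub hn hs hs1 hΩ hb hLip hφ hu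
    (truncate_mem_WExt hΩm hb hN hu)
  set f : Eucl n × Eucl n → ℝ := fun p => areaIntegrand n s u p -
      areaIntegrand n s (truncate Ω (Metric.diam Ω + m) u u) p with hf
  rw [Q_eq] at hint ⊢
  have hint1 := hint.mono_set Set.subset_union_left
  have hint2 := hint.mono_set Set.subset_union_right
  have hint3 := hint2.mono_set Set.subset_union_left
  have hint4 := hint2.mono_set Set.subset_union_right
  have hdisj : Disjoint Ω Ωᶜ := disjoint_compl_right
  have h1 : 0 ≤ ∫ p in Ω ×ˢ Ω, f p := by
    refine setIntegral_nonneg (hΩm.prod hΩm) fun p hp => ?_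
    simp only [hf, areaIntegrand_eq, truncate_of_mem hp.1, truncate_of_mem hp.2, sub_nonneg]
    exact pairEnergy_mono_abs (norm_nonneg _) (abs_clamp_sub_clamp_le _ _ _)
  have h2 : 0 ≤ ∫ p in Ω ×ˢ Ωᶜ, f p := by
    rw [Measure.volume_eq_prod, setIntegral_prod _ hint3]
    exact setIntegral_nonneg hΩm fun x hx => truncate_slice_nonneg hn hs hΩ hb hΘ hm' hx
  have h3 : ∫ p in Ωᶜ ×ˢ Ω, f p = ∫ p in Ω ×ˢ Ωᶜ, f p := by
    rw [Measure.volume_eq_prod, ← setIntegral_prod_swap]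
    simp only [hf, areaIntegrand_swap]
  rw [setIntegral_union _ ((hΩm.prod hΩm.compl).union (hΩm.compl.prod hΩm)) hint1 hint2,
    setIntegral_union _ (hΩm.compl.prod hΩm) hint3 hint4, h3]
  · linarith
  · exact Set.Disjoint.set_prod_left hdisj _ _
  · exact Disjoint.union_right (Set.Disjoint.set_prod_right hdisj _ _)
      (Set.Disjoint.set_prod_left hdisj _ _)

/-! ### Minimization of convex functionals and the relative energy -/

/-- A decreasing sequence of nonempty bounded closed convex sets of a Hilbert space has a common
point: the elements of least norm form a Cauchy sequence, by the parallelogram law. -/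
lemma nonempty_iInter_of_convex {H : Type*} [NormedAddCommGroup H] [InnerProductSpace ℝ H]
    [CompleteSpace H] {S : ℕ → Set H} (hanti : Antitone S) (hne : ∀ k, (S k).Nonempty)
    (hcl : ∀ k, IsClosed (S k)) (hcv : ∀ k, Convex ℝ (S k)) {R : ℝ}
    (hR : ∀ f ∈ S 0, ‖f‖ ≤ R) : (⋂ k, S k).Nonempty := by
  have hmin : ∀ k, ∃ p ∈ S k, ∀ f ∈ S k, ‖p‖ ≤ ‖f‖ := fun k => by
    obtain ⟨p, hp, hpm⟩ := exists_norm_eq_iInf_of_complete_convex (hne k) (hcl k).isComplete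
      (hcv k) 0
    refine ⟨p, hp, fun f hf => ?_⟩
    rw [zero_sub, norm_neg] at hpm
    rw [hpm]
    refine (ciInf_le ⟨0, ?_⟩ (⟨f, hf⟩ : S k)).trans_eq (by simp)
    rintro _ ⟨w, rfl⟩
    exact norm_nonneg _
  choose p hp hpm using hmin
  have hmono : Monotone fun k => ‖p k‖ ^ 2 := fun k l hkl =>
    pow_le_pow_left₀ (norm_nonneg _) (hpm k _ (hanti hkl (hp l))) 2
  have hbdd : BddAbove (Set.range fun k => ‖p k‖ ^ 2) := by
    refine ⟨R ^ 2, ?_⟩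
    rintro _ ⟨k, rfl⟩
    exact pow_le_pow_left₀ (norm_nonneg _) (hR _ (hanti (Nat.zero_le k) (hp k))) 2
  have hlim := tendsto_atTop_ciSup hmono hbdd
  have hpar : ∀ k l, k ≤ l → ‖p l - p k‖ ^ 2 ≤ 2 * (‖p l‖ ^ 2 - ‖p k‖ ^ 2) := fun k l hkl => by
    have hmem : (1 / 2 : ℝ) • p l + (1 / 2 : ℝ) • p k ∈ S k :=
      hcv k (hanti hkl (hp l)) (hp k) (by norm_num) (by norm_num) (by norm_num)
    have h1 := hpm k _ hmem
    rw [← smul_add, norm_smul, Real.norm_of_nonneg (by norm_num)] at h1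
    have h2 := parallelogram_law_with_norm ℝ (p l) (p k)
    nlinarith [norm_nonneg (p k), norm_nonneg (p l + p k)]
  have hcauchy : CauchySeq p := by
    refine Metric.cauchySeq_iff'.2 fun ε hε => ?_
    obtain ⟨N, hN⟩ := Filter.eventually_atTop.1
      (hlim.eventually (lt_mem_nhds (sub_lt_self _ (show 0 < ε ^ 2 / 2 by positivity))))
    refine ⟨N, fun l hl => ?_⟩
    have h1 := hpar N l hl
    have h2 := hN N le_rfl
    have h3 := le_ciSup hbdd l
    rw [dist_eq_norm]
    refine lt_of_pow_lt_pow_left₀ 2 hε.le ?_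
    linarith
  obtain ⟨f, hf⟩ := cauchySeq_tendsto_of_complete hcauchy
  refine ⟨f, Set.mem_iInter.2 fun k => (hcl k).mem_of_tendsto hf ?_⟩
  exact Filter.eventually_atTop.2 ⟨k, fun l hl => hanti hl (hp l)⟩

/-- Existence of minimizers: a function on a bounded set of a Hilbert space whose sublevel sets
are convex and closed attains its infimum. -/
lemma exists_minimizer_of_convex {H : Type*} [NormedAddCommGroup H] [InnerProductSpace ℝ H]
    [CompleteSpace H] {C : Set H} (hne : C.Nonempty) {R : ℝ} (hR : ∀ f ∈ C, ‖f‖ ≤ R)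
    {F : H → ENNReal} (hcl : ∀ c, IsClosed {f | f ∈ C ∧ F f ≤ c})
    (hcv : ∀ c, Convex ℝ {f | f ∈ C ∧ F f ≤ c}) : ∃ f ∈ C, ∀ g ∈ C, F f ≤ F g := by
  have : Nonempty C := hne.to_subtype
  by_cases htop : ⨅ g : C, F g = ⊤
  · obtain ⟨f, hf⟩ := hne
    exact ⟨f, hf, fun g hg => le_top.trans (htop ▸ iInf_le (fun g : C => F g) ⟨g, hg⟩)⟩
  obtain ⟨c, hanti, hc, hlim⟩ := exists_seq_strictAnti_tendsto' (lt_top_iff_ne_top.2 htop)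
  obtain ⟨f, hf⟩ := nonempty_iInter_of_convex (S := fun k => {f | f ∈ C ∧ F f ≤ c k})
    (fun k l hkl f hf => ⟨hf.1, hf.2.trans (hanti.antitone hkl)⟩)
    (fun k => by
      obtain ⟨g, hg⟩ := iInf_lt_iff.1 (hc k).1
      exact ⟨g, g.2, hg.le⟩)
    (fun k => hcl _) (fun k => hcv _) (fun f hf => hR f hf.1)
  rw [Set.mem_iInter] at hf
  refine ⟨f, (hf 0).1, fun g hg => ?_⟩
  exact (ge_of_tendsto' hlim fun k => (hf k).2).trans (iInf_le (fun g : C => F g) ⟨g, hg⟩)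

lemma ae_prod_of_ae {P : Eucl n → Prop} (h : ∀ᵐ x, P x) :
    ∀ᵐ p : Eucl n × Eucl n, P p.1 ∧ P p.2 := by
  rw [Measure.volume_eq_prod]
  exact (Measure.quasiMeasurePreserving_fst.ae h).and (Measure.quasiMeasurePreserving_snd.ae h)

/-- The energy of `v` relative to a reference function `v₀`, with a correction `h` that is chosen
so that the integrand is nonnegative for the functions `v` of interest. -/
noncomputable def relEnergy (s : ℝ) (Ω : Set (Eucl n)) (v₀ : Eucl n → ℝ) (h : Eucl n × Eucl n → ℝ)
    (v : Eucl n → ℝ) : ENNReal :=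
  ∫⁻ p in Q Ω, ENNReal.ofReal (areaIntegrand n s v p - areaIntegrand n s v₀ p + h p)

lemma relEnergy_congr {Ω : Set (Eucl n)} {v₀ v w : Eucl n → ℝ} {h : Eucl n × Eucl n → ℝ}
    (hvw : v =ᵐ[volume] w) : relEnergy s Ω v₀ h v = relEnergy s Ω v₀ h w := by
  refine lintegral_congr_ae (ae_restrict_of_ae ?_)
  filter_upwards [ae_prod_of_ae hvw] with p hp
  rw [areaIntegrand_eq v, areaIntegrand_eq w, hp.1, hp.2]

lemma relEnergy_convex {Ω : Set (Eucl n)} {v₀ v w : Eucl n → ℝ} {h : Eucl n × Eucl n → ℝ}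
    (hv₀ : AEMeasurable v₀) (hh : AEMeasurable h) (hv : AEMeasurable v)
    {a b : ℝ} (ha : 0 ≤ a) (hb : 0 ≤ b) (hab : a + b = 1) :
    relEnergy s Ω v₀ h (fun x => a * v x + b * w x) ≤
      ENNReal.ofReal a * relEnergy s Ω v₀ h v + ENNReal.ofReal b * relEnergy s Ω v₀ h w := by
  have hm : AEMeasurable fun p =>
      ENNReal.ofReal (areaIntegrand n s v p - areaIntegrand n s v₀ p + h p) :=
    (((aemeasurable_areaIntegrand hv).sub (aemeasurable_areaIntegrand hv₀)).add hh).ennreal_ofReal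
  rw [relEnergy, relEnergy, relEnergy, ← lintegral_const_mul' _ _ ENNReal.ofReal_ne_top,
    ← lintegral_const_mul' _ _ ENNReal.ofReal_ne_top,
    ← lintegral_add_left' (hm.restrict.const_mul _)]
  refine lintegral_mono fun p => ?_
  rw [← ENNReal.ofReal_mul ha, ← ENNReal.ofReal_mul hb]
  refine (ENNReal.ofReal_le_ofReal ?_).trans ENNReal.ofReal_add_le
  have h1 := pairEnergy_convex (n := n) (s := s) (norm_nonneg (p.1 - p.2)) ha hb hab
    (v p.1 - v p.2) (w p.1 - w p.2)
  rw [areaIntegrand_eq, areaIntegrand_eq v, areaIntegrand_eq w,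
    show a * v p.1 + b * w p.1 - (a * v p.2 + b * w p.2) =
      a * (v p.1 - v p.2) + b * (w p.1 - w p.2) by ring]
  have h2 : h p - areaIntegrand n s v₀ p = a * (h p - areaIntegrand n s v₀ p) +
      b * (h p - areaIntegrand n s v₀ p) := by rw [← add_mul, hab, one_mul]
  linarith

lemma continuous_pairEnergy (n : ℕ) (s r : ℝ) : Continuous (pairEnergy n s r) :=
  ((continuous_scriptG n s).comp (continuous_id.div_const r)).div_const _

/-- Lower semicontinuity of the relative energy under convergence almost everywhere. -/
lemma relEnergy_le_of_tendsto {Ω : Set (Eucl n)} {v₀ v : Eucl n → ℝ} {w : ℕ → Eucl n → ℝ}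
    {h : Eucl n × Eucl n → ℝ} (hv₀ : AEMeasurable v₀) (hh : AEMeasurable h)
    (hw : ∀ k, AEMeasurable (w k))
    (hlim : ∀ᵐ x, Filter.Tendsto (fun k => w k x) Filter.atTop (nhds (v x))) {c : ENNReal}
    (hc : ∀ k, relEnergy s Ω v₀ h (w k) ≤ c) : relEnergy s Ω v₀ h v ≤ c := by
  calc relEnergy s Ω v₀ h v
      = ∫⁻ p in Q Ω, Filter.liminf (fun k => ENNReal.ofReal (areaIntegrand n s (w k) p -
          areaIntegrand n s v₀ p + h p)) Filter.atTop := by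
        refine lintegral_congr_ae (ae_restrict_of_ae ?_)
        filter_upwards [ae_prod_of_ae hlim] with p hp
        refine (Filter.Tendsto.liminf_eq (ENNReal.tendsto_ofReal ?_)).symm
        refine Filter.Tendsto.add_const _ (Filter.Tendsto.sub_const ?_ _)
        exact ((continuous_pairEnergy n s _).tendsto _).comp (hp.1.sub hp.2)
    _ ≤ Filter.liminf (fun k => relEnergy s Ω v₀ h (w k)) Filter.atTop :=
        lintegral_liminf_le' fun k => (((aemeasurable_areaIntegrand (hw k)).sub
          (aemeasurable_areaIntegrand hv₀)).add hh).ennreal_ofReal.restrict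
    _ ≤ c := Filter.liminf_le_of_le (by isBoundedDefault) fun b hb => by
        obtain ⟨k, hk⟩ := hb.exists
        exact hk.trans (hc k)

/-! ### Minimizers among bounded competitors -/

lemma const_mem_W {Ω : Set (Eucl n)} (hΩ : MeasurableSet Ω) (hb : Bornology.IsBounded Ω)
    {u : Eucl n → ℝ} {c : ℝ} (hu : ∀ x ∈ Ω, u x = c) : u ∈ W s Ω := by
  have hint : IntegrableOn (fun _ : Eucl n => c) Ω := integrableOn_const hb.measure_lt_top.ne
  refine ⟨hint.congr_fun (fun x hx => (hu x hx).symm) hΩ, ?_⟩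
  rw [gagliardo_congr_ae (v := fun _ => c)
    ((ae_restrict_iff' hΩ).2 (Filter.Eventually.of_forall hu))]
  simp [gagliardo]

lemma clamp_of_abs_le {N a : ℝ} (h : |a| ≤ N) : clamp N a = a := by
  rw [abs_le] at h
  rw [clamp, min_eq_left h.2, max_eq_right h.1]

lemma aemeasurable_truncate {Ω : Set (Eucl n)} (hΩ : MeasurableSet Ω) {N : ℝ} {φ f : Eucl n → ℝ}
    (hφ : AEMeasurable φ (volume.restrict Ωᶜ)) (hf : AEMeasurable f (volume.restrict Ω)) :
    AEMeasurable (truncate Ω N φ f) := by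
  have h1 : AEMeasurable (truncate Ω N φ f) (volume.restrict Ω) :=
    ((measurable_clamp N).comp_aemeasurable hf).congr ((ae_restrict_iff' hΩ).2
      (Filter.Eventually.of_forall fun x hx => (truncate_of_mem hx N φ f).symm))
  have h2 : AEMeasurable (truncate Ω N φ f) (volume.restrict Ωᶜ) :=
    hφ.congr ((ae_restrict_iff' hΩ.compl).2
      (Filter.Eventually.of_forall fun x hx => (truncate_of_notMem hx N φ f).symm))
  have := aemeasurable_union_iff.2 ⟨h1, h2⟩
  rwa [Set.union_compl_self, Measure.restrict_univ] at this

/-- The reference competitor, equal to the constant `N` inside `Ω`. -/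
noncomputable def reference (Ω : Set (Eucl n)) (N : ℝ) (φ : Eucl n → ℝ) : Eucl n → ℝ :=
  truncate Ω N φ fun _ => N

lemma reference_of_mem {Ω : Set (Eucl n)} {N : ℝ} (hN : 0 ≤ N) (φ : Eucl n → ℝ) {x : Eucl n}
    (hx : x ∈ Ω) : reference Ω N φ x = N := by
  rw [reference, truncate_of_mem hx, clamp_of_abs_le (abs_of_nonneg hN).le]

lemma reference_of_notMem {Ω : Set (Eucl n)} {N : ℝ} (φ : Eucl n → ℝ) {x : Eucl n}
    (hx : x ∈ Ωᶜ) : reference Ω N φ x = φ x := truncate_of_notMem hx _ _ _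

lemma reference_mem_WExt {Ω : Set (Eucl n)} (hΩ : MeasurableSet Ω) (hb : Bornology.IsBounded Ω)
    {N : ℝ} (hN : 0 ≤ N) (φ : Eucl n → ℝ) : reference Ω N φ ∈ WExt s Ω φ :=
  ⟨const_mem_W hΩ hb fun _ hx => reference_of_mem hN φ hx, fun _ hx => reference_of_notMem φ hx⟩

/-- Twice `|d(x) - d(y)| |x - y|^(-(n+s))` for the function `d` equal to `2 N` inside `Ω` and to
zero outside. It vanishes on `Ω × Ω`, and on pairs with one point outside `Ω` it dominates the change of
the integrand when a function bounded by `N` replaces another one. -/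
noncomputable def correction (s : ℝ) (Ω : Set (Eucl n)) (N : ℝ) (p : Eucl n × Eucl n) : ℝ :=
  2 * (|Ω.indicator (fun _ => 2 * N) p.1 - Ω.indicator (fun _ => 2 * N) p.2| *
    kernel s (p.1 - p.2))

lemma measurable_correction {Ω : Set (Eucl n)} (hΩ : MeasurableSet Ω) (N : ℝ) :
    Measurable (correction s Ω N) := by
  have h1 : Measurable (Ω.indicator fun _ : Eucl n => 2 * N) := measurable_const.indicator hΩ
  have h2 : Measurable fun p : Eucl n × Eucl n => kernel s (p.1 - p.2) :=
    measurable_kernel.comp (by fun_prop)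
  unfold correction
  have h3 : Measurable fun p : Eucl n × Eucl n =>
      |Ω.indicator (fun _ => 2 * N) p.1 - Ω.indicator (fun _ => 2 * N) p.2| :=
    continuous_abs.measurable.comp ((h1.comp measurable_fst).sub (h1.comp measurable_snd))
  exact (h3.mul h2).const_mul 2

lemma correction_nonneg (Ω : Set (Eucl n)) (N : ℝ) (p : Eucl n × Eucl n) :
    0 ≤ correction s Ω N p :=
  mul_nonneg zero_le_two (mul_nonneg (abs_nonneg _) (kernel_nonneg _))

lemma integrableOn_correction (hs : 0 < s) (hs1 : s < 1) {Ω : Set (Eucl n)} (hΩ : IsOpen Ω)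
    (hb : Bornology.IsBounded Ω) (hLip : HasLipschitzBoundary Ω) (N : ℝ) :
    IntegrableOn (correction s Ω N) (Q Ω) := by
  refine ⟨(measurable_correction hΩ.measurableSet N).aestronglyMeasurable, ?_⟩
  have hmem : (Ω.indicator fun _ : Eucl n => 2 * N) ∈ W s Ω :=
    const_mem_W hΩ.measurableSet hb fun x hx => Set.indicator_of_mem hx _
  have hfin := lintegral_Q_gagliardoIntegrand_lt_top hs hs1 hΩ hb hLip hmem
    (measurable_const.indicator hΩ.measurableSet).aemeasurable
    (fun x hx => Set.indicator_of_notMem hx _)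
  refine lt_of_le_of_lt (lintegral_mono (g := fun p =>
    ENNReal.ofReal 2 * gagliardoIntegrand s (Ω.indicator fun _ => 2 * N) p) fun p => ?_) ?_
  · simp only [gagliardoIntegrand]
    rw [Real.enorm_eq_ofReal_abs, abs_of_nonneg (correction_nonneg _ _ _),
      ← ENNReal.ofReal_mul zero_le_two, correction]
  · rw [lintegral_const_mul' _ _ ENNReal.ofReal_ne_top]
    exact ENNReal.mul_lt_top ENNReal.ofReal_lt_top hfin

lemma relEnergy_integrand_of_mem {Ω : Set (Eucl n)} {N : ℝ} (hN : 0 ≤ N) (φ v : Eucl n → ℝ)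
    {p : Eucl n × Eucl n} (hp : p ∈ Ω ×ˢ Ω) :
    areaIntegrand n s v p - areaIntegrand n s (reference Ω N φ) p + correction s Ω N p =
      areaIntegrand n s v p := by
  rw [areaIntegrand_eq (reference Ω N φ), reference_of_mem hN φ hp.1, reference_of_mem hN φ hp.2,
    sub_self, pairEnergy_zero, correction, Set.indicator_of_mem hp.1, Set.indicator_of_mem hp.2,
    sub_self, abs_zero, zero_mul, mul_zero, sub_zero, add_zero]

/-- On `Ω × Ω` the reference function and the correction do not contribute; on the other pairs of
`Q(Ω)` the correction compensates the difference of the integrands. -/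
lemma relEnergy_integrand_nonneg (hn : 1 ≤ n) (hs : 0 < s) {Ω : Set (Eucl n)} {N : ℝ}
    (hN : 0 ≤ N) {φ v : Eucl n → ℝ} (hv : ∀ x ∈ Ω, |v x| ≤ N) (hvφ : ∀ x ∈ Ωᶜ, v x = φ x)
    {p : Eucl n × Eucl n} (hp : p ∈ Q Ω) :
    0 ≤ areaIntegrand n s v p - areaIntegrand n s (reference Ω N φ) p + correction s Ω N p := by
  have key := (abs_le.1 (abs_areaIntegrand_sub_le hn hs v (reference Ω N φ) p)).1
  have hbound : ∀ x ∈ Ω, |v x - reference Ω N φ x| ≤ 2 * N := fun x hx => by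
    rw [reference_of_mem hN φ hx]
    have := abs_le.1 (hv x hx)
    rw [abs_le]
    constructor <;> linarith
  rw [Q_eq] at hp
  have hle : |v p.1 - reference Ω N φ p.1 - (v p.2 - reference Ω N φ p.2)| ≤
      |Ω.indicator (fun _ => 2 * N) p.1 - Ω.indicator (fun _ => 2 * N) p.2| →
      0 ≤ areaIntegrand n s v p - areaIntegrand n s (reference Ω N φ) p + correction s Ω N p := by
    intro h
    have := mul_le_mul_of_nonneg_right h (kernel_nonneg (s := s) (p.1 - p.2))
    rw [correction]
    linarith
  rcases hp with hp | hp | hp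
  · rw [relEnergy_integrand_of_mem hN φ v hp, areaIntegrand_eq]
    exact pairEnergy_nonneg (norm_nonneg _) _
  · refine hle ?_
    rw [Set.indicator_of_mem hp.1, Set.indicator_of_notMem hp.2, reference_of_notMem φ hp.2,
      hvφ _ hp.2, sub_self, sub_zero, sub_zero, abs_of_nonneg (by positivity : 0 ≤ 2 * N)]
    exact hbound _ hp.1
  · refine hle ?_
    rw [Set.indicator_of_mem hp.2, Set.indicator_of_notMem hp.1, reference_of_notMem φ hp.1,
      hvφ _ hp.1, sub_self, zero_sub, zero_sub, abs_neg, abs_neg,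
      abs_of_nonneg (by positivity : 0 ≤ 2 * N)]
    exact hbound _ hp.2

lemma relEnergy_eq_ofReal (hn : 1 ≤ n) (hs : 0 < s) (hs1 : s < 1) {Ω : Set (Eucl n)}
    (hΩ : IsOpen Ω) (hb : Bornology.IsBounded Ω) (hLip : HasLipschitzBoundary Ω) {N : ℝ}
    (hN : 0 ≤ N) {φ v : Eucl n → ℝ} (hφ : AEMeasurable φ (volume.restrict Ωᶜ))
    (hv : v ∈ WExt s Ω φ) (hvN : ∀ x ∈ Ω, |v x| ≤ N) :
    relEnergy s Ω (reference Ω N φ) (correction s Ω N) v =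
      ENNReal.ofReal (∫ p in Q Ω, (areaIntegrand n s v p -
        areaIntegrand n s (reference Ω N φ) p + correction s Ω N p)) := by
  rw [relEnergy, ofReal_integral_eq_lintegral_ofReal]
  · exact (integrableOn_areaIntegrand_sub hn hs hs1 hΩ hb hLip hφ hv
      (reference_mem_WExt hΩ.measurableSet hb hN φ)).add
      (integrableOn_correction hs hs1 hΩ hb hLip N)
  · exact (ae_restrict_iff' (measurableSet_Q hΩ.measurableSet)).2
      (Filter.Eventually.of_forall fun p hp => relEnergy_integrand_nonneg hn hs hN hvN hv.2 hp)

/-- Finiteness of the relative energy implies membership in `W^{s,1}`, since `𝒢_s` grows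
linearly. -/
lemma mem_WExt_of_relEnergy_lt_top (hn : 1 ≤ n) (hs1 : s < 1) {Ω : Set (Eucl n)}
    (hΩ : IsOpen Ω) (hb : Bornology.IsBounded Ω) {N : ℝ} (hN : 0 ≤ N) {φ v : Eucl n → ℝ}
    (hvm : AEMeasurable v) (hvN : ∀ x ∈ Ω, |v x| ≤ N) (hvφ : ∀ x ∈ Ωᶜ, v x = φ x)
    (hfin : relEnergy s Ω (reference Ω N φ) (correction s Ω N) v < ⊤) : v ∈ WExt s Ω φ := by
  have hΩm := hΩ.measurableSet
  refine ⟨⟨IntegrableOn.of_bound hb.measure_lt_top hvm.aestronglyMeasurable.restrict N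
    ((ae_restrict_iff' hΩm).2 (Filter.Eventually.of_forall hvN)), ?_⟩, hvφ⟩
  have hweak := lintegral_weak_kernel_lt_top hn hs1 hb
  have hwm : Measurable fun p : Eucl n × Eucl n =>
      ENNReal.ofReal ((‖p.1 - p.2‖ ^ ((n : ℝ) - 1 + s))⁻¹) := by fun_prop
  have hweak' : ∫⁻ p in Ω ×ˢ Ω, ENNReal.ofReal ((‖p.1 - p.2‖ ^ ((n : ℝ) - 1 + s))⁻¹) < ⊤ := by
    rwa [Measure.volume_eq_prod, ← Measure.prod_restrict, lintegral_prod _ hwm.aemeasurable]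
  have harea : ∫⁻ p in Ω ×ˢ Ω, ENNReal.ofReal (areaIntegrand n s v p) < ⊤ := by
    refine lt_of_le_of_lt ?_ hfin
    rw [relEnergy, Q_eq]
    refine le_trans (le_of_eq ?_) (lintegral_mono_set Set.subset_union_left)
    refine setLIntegral_congr_fun (hΩm.prod hΩm) fun p hp => ?_
    rw [relEnergy_integrand_of_mem hN φ v hp]
  have hG : 0 < G n s 1 := by simpa using strictMono_G n s one_pos
  rw [gagliardo_eq_prod_of_aemeasurable hvm.restrict]
  refine lt_of_le_of_lt (lintegral_mono (g := fun p =>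
    ENNReal.ofReal (G n s 1)⁻¹ * ENNReal.ofReal (areaIntegrand n s v p) +
      ENNReal.ofReal ((‖p.1 - p.2‖ ^ ((n : ℝ) - 1 + s))⁻¹)) fun p => ?_) ?_
  · simp only [gagliardoIntegrand]
    have hF : 0 ≤ areaIntegrand n s v p := pairEnergy_nonneg (norm_nonneg _) _
    rw [← ENNReal.ofReal_mul (by positivity), ← ENNReal.ofReal_add (by positivity) (by positivity)]
    refine ENNReal.ofReal_le_ofReal ?_
    rcases eq_or_ne p.1 p.2 with h | h
    · rw [h, sub_self, abs_zero, zero_mul]; positivity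
    · have := pairEnergy_le_add (n := n) (s := s) (norm_pos_iff.2 (sub_ne_zero.2 h))
        (v p.1 - v p.2)
      rwa [div_eq_mul_inv] at this
  · rw [lintegral_add_right _ hwm, lintegral_const_mul' _ _ ENNReal.ofReal_ne_top]
    exact ENNReal.add_lt_top.2 ⟨ENNReal.mul_lt_top ENNReal.ofReal_lt_top harea, hweak'⟩

lemma relEnergy_le_iff_integral_nonpos (hn : 1 ≤ n) (hs : 0 < s) (hs1 : s < 1)
    {Ω : Set (Eucl n)} (hΩ : IsOpen Ω) (hb : Bornology.IsBounded Ω)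
    (hLip : HasLipschitzBoundary Ω) {N : ℝ} (hN : 0 ≤ N) {φ u v : Eucl n → ℝ}
    (hφ : AEMeasurable φ (volume.restrict Ωᶜ)) (hu : u ∈ WExt s Ω φ) (huN : ∀ x ∈ Ω, |u x| ≤ N)
    (hv : v ∈ WExt s Ω φ) (hvN : ∀ x ∈ Ω, |v x| ≤ N) :
    relEnergy s Ω (reference Ω N φ) (correction s Ω N) u ≤
      relEnergy s Ω (reference Ω N φ) (correction s Ω N) v ↔
    ∫ p in Q Ω, (areaIntegrand n s u p - areaIntegrand n s v p) ≤ 0 := by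
  have href := reference_mem_WExt (s := s) hΩ.measurableSet hb hN φ
  have hcor := integrableOn_correction hs hs1 hΩ hb hLip N
  have hiu := (integrableOn_areaIntegrand_sub hn hs hs1 hΩ hb hLip hφ hu href).add hcor
  have hiv := (integrableOn_areaIntegrand_sub hn hs hs1 hΩ hb hLip hφ hv href).add hcor
  rw [relEnergy_eq_ofReal hn hs hs1 hΩ hb hLip hN hφ hu huN,
    relEnergy_eq_ofReal hn hs hs1 hΩ hb hLip hN hφ hv hvN, ENNReal.ofReal_le_ofReal_iff]
  · have h := integral_sub hiu hiv
    simp only [Pi.add_apply] at h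
    rw [← sub_nonpos, ← h]
    refine iff_of_eq (congrArg (· ≤ 0) (integral_congr_ae ?_))
    exact Filter.Eventually.of_forall fun p => by simp only; ring
  · exact setIntegral_nonneg (measurableSet_Q hΩ.measurableSet) fun p hp =>
      relEnergy_integrand_nonneg hn hs hN hvN hv.2 hp

/-- Existence of a minimizer among the competitors bounded by `N` in `Ω`. -/
theorem exists_bounded_minimizer (hn : 1 ≤ n) (hs : 0 < s) (hs1 : s < 1)
    {Ω A : Set (Eucl n)} (hΩ : IsOpen Ω) (hb : Bornology.IsBounded Ω)
    (hLip : HasLipschitzBoundary Ω) (hA : MeasurableSet A) (hAΩ : A ⊆ Ω) {N : ℝ} (hN : 0 ≤ N)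
    {φ ψ : Eucl n → ℝ} (hφ : AEMeasurable φ (volume.restrict Ωᶜ))
    (hψ : ∀ᵐ x ∂volume.restrict A, ψ x ≤ N) :
    ∃ u ∈ WObst s Ω A φ ψ, (∀ x ∈ Ω, |u x| ≤ N) ∧
      ∀ v ∈ WObst s Ω A φ ψ, (∀ x ∈ Ω, |v x| ≤ N) →
        ∫ p in Q Ω, (areaIntegrand n s u p - areaIntegrand n s v p) ≤ 0 := by
  have hΩm := hΩ.measurableSet
  have hfinite : IsFiniteMeasure (volume.restrict Ω) := ⟨by simpa using hb.measure_lt_top⟩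
  have href := reference_mem_WExt (s := s) hΩm hb hN φ
  have hrefm := aemeasurable_of_mem_WExt hΩm hφ href
  have hcorm := (measurable_correction (s := s) hΩm N).aemeasurable (μ := volume)
  set E : (Eucl n → ℝ) → ENNReal := relEnergy s Ω (reference Ω N φ) (correction s Ω N) with hE
  let C : Set (Lp ℝ 2 (volume.restrict Ω)) :=
    {f | ∀ᵐ x ∂volume.restrict Ω, |f x| ≤ N ∧ (x ∈ A → ψ x ≤ f x)}
  have hfm : ∀ f : Lp ℝ 2 (volume.restrict Ω), AEMeasurable (truncate Ω N φ f) := fun f =>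
    aemeasurable_truncate hΩm hφ (Lp.aestronglyMeasurable f).aemeasurable
  have hbdd : ∀ f : Eucl n → ℝ, ∀ x ∈ Ω, |truncate Ω N φ f x| ≤ N := fun f x hx => by
    rw [truncate_of_mem hx]; exact abs_clamp_le hN _
  have hae : ∀ {f g : Eucl n → ℝ}, (∀ᵐ x ∂volume.restrict Ω, clamp N (f x) = g x) →
      (∀ x ∈ Ωᶜ, g x = φ x) → truncate Ω N φ f =ᵐ[volume] g := fun h hg => by
    filter_upwards [(ae_restrict_iff' hΩm).1 h] with x hx
    by_cases hxΩ : x ∈ Ω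
    · rw [truncate_of_mem hxΩ, hx hxΩ]
    · rw [truncate_of_notMem hxΩ, hg x hxΩ]
  -- a competitor bounded by `N` is represented by an element of `C`
  have hrep : ∀ v ∈ WObst s Ω A φ ψ, (∀ x ∈ Ω, |v x| ≤ N) →
      ∃ f ∈ C, truncate Ω N φ f =ᵐ[volume] v := by
    intro v hv hvN
    have hmem : MemLp v 2 (volume.restrict Ω) := MemLp.of_bound
      hv.1.1.1.aestronglyMeasurable N ((ae_restrict_iff' hΩm).2 (Filter.Eventually.of_forall hvN))
    have hco := hmem.coeFn_toLp
    refine ⟨hmem.toLp v, ?_, hae ?_ hv.1.2⟩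
    · have h2 := ae_restrict_of_ae (s := Ω) ((ae_restrict_iff' hA).1 hv.2)
      filter_upwards [hco, ae_restrict_mem hΩm, h2] with x hx hxΩ hxψ
      rw [hx]
      exact ⟨hvN x hxΩ, hxψ⟩
    · filter_upwards [hco, ae_restrict_mem hΩm] with x hx hxΩ
      rw [hx, clamp_of_abs_le (hvN x hxΩ)]
  have hrefObst : reference Ω N φ ∈ WObst s Ω A φ ψ := by
    refine ⟨href, ?_⟩
    filter_upwards [hψ, ae_restrict_mem hA] with x hx hxA
    rwa [reference_of_mem hN φ (hAΩ hxA)]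
  have hrefN : ∀ x ∈ Ω, |reference Ω N φ x| ≤ N := fun x hx => by
    rw [reference_of_mem hN φ hx, abs_of_nonneg hN]
  obtain ⟨f₀, hf₀C, hf₀⟩ := hrep _ hrefObst hrefN
  have hcv : ∀ c, Convex ℝ {f | f ∈ C ∧ E (truncate Ω N φ f) ≤ c} := by
    rintro c f ⟨hf, hfc⟩ g ⟨hg, hgc⟩ a b ha hb' hab
    have hco : ∀ᵐ x ∂volume.restrict Ω, (a • f + b • g : Lp ℝ 2 (volume.restrict Ω)) x =
        a * f x + b * g x := by
      filter_upwards [Lp.coeFn_add (a • f) (b • g), Lp.coeFn_smul a f, Lp.coeFn_smul b g]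
        with x h1 h2 h3
      rw [h1, Pi.add_apply, h2, h3]; rfl
    have hmem : (a • f + b • g) ∈ C := by
      filter_upwards [hf, hg, hco] with x hfx hgx hx
      rw [hx]
      refine ⟨?_, fun hxA => ?_⟩
      · refine (abs_add_le _ _).trans ?_
        rw [abs_mul, abs_mul, abs_of_nonneg ha, abs_of_nonneg hb']
        calc a * |f x| + b * |g x| ≤ a * N + b * N := by gcongr; exacts [hfx.1, hgx.1]
          _ = N := by rw [← add_mul, hab, one_mul]
      · calc ψ x = a * ψ x + b * ψ x := by rw [← add_mul, hab, one_mul]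
          _ ≤ _ := by gcongr; exacts [hfx.2 hxA, hgx.2 hxA]
    refine ⟨hmem, ?_⟩
    have hcomb : truncate Ω N φ (a • f + b • g : Lp ℝ 2 (volume.restrict Ω)) =ᵐ[volume]
        fun x => a * truncate Ω N φ f x + b * truncate Ω N φ g x := by
      refine hae ?_ fun x hx => ?_
      · filter_upwards [hf, hg, hmem, hco, ae_restrict_mem hΩm] with x hfx hgx hx hx' hxΩ
        rw [truncate_of_mem hxΩ, truncate_of_mem hxΩ, clamp_of_abs_le hx.1,
          clamp_of_abs_le hfx.1, clamp_of_abs_le hgx.1, hx']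
      · rw [truncate_of_notMem hx, truncate_of_notMem hx, ← add_mul, hab, one_mul]
    rw [hE, relEnergy_congr hcomb]
    refine (relEnergy_convex hrefm hcorm (hfm f) ha hb' hab).trans ?_
    calc _ ≤ ENNReal.ofReal a * c + ENNReal.ofReal b * c := by gcongr
      _ = c := by rw [← add_mul, ← ENNReal.ofReal_add ha hb', hab, ENNReal.ofReal_one, one_mul]
  have hcl : ∀ c, IsClosed {f | f ∈ C ∧ E (truncate Ω N φ f) ≤ c} := by
    intro c
    refine IsSeqClosed.isClosed fun w f hw hlim => ?_
    obtain ⟨k, -, hk⟩ := (tendstoInMeasure_of_tendsto_Lp hlim).exists_seq_tendsto_ae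
    have hall : ∀ᵐ x ∂volume.restrict Ω, ∀ j, |w (k j) x| ≤ N ∧ (x ∈ A → ψ x ≤ w (k j) x) :=
      ae_all_iff.2 fun j => (hw (k j)).1
    refine ⟨?_, ?_⟩
    · filter_upwards [hk, hall] with x hx hxN
      exact ⟨le_of_tendsto' hx.abs fun j => (hxN j).1,
        fun hxA => ge_of_tendsto' hx fun j => (hxN j).2 hxA⟩
    · refine relEnergy_le_of_tendsto hrefm hcorm (fun j => hfm (w (k j))) ?_
        fun j => (hw (k j)).2
      filter_upwards [(ae_restrict_iff' hΩm).1 hk] with x hx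
      by_cases hxΩ : x ∈ Ω
      · simp only [truncate_of_mem hxΩ]
        have hcont : Continuous (clamp N) := by unfold clamp; fun_prop
        exact (hcont.tendsto _).comp (hx hxΩ)
      · simp only [truncate_of_notMem (show x ∈ Ωᶜ from hxΩ)]
        exact tendsto_const_nhds
  have hnorm : ∀ f ∈ C, ‖f‖ ≤
      ((volume.restrict Ω) Set.univ).toReal ^ (ENNReal.toReal 2)⁻¹ * N := fun f hf => by
    refine Lp.norm_le_of_ae_bound hN ?_
    filter_upwards [hf] with x hx
    exact hx.1
  obtain ⟨f, hfC, hfmin⟩ := exists_minimizer_of_convex (F := fun f => E (truncate Ω N φ f))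
    ⟨f₀, hf₀C⟩ hnorm hcl hcv
  set u := truncate Ω N φ f with hu
  have hlt : E u < ⊤ := by
    refine (hfmin f₀ hf₀C).trans_lt ?_
    simp only [hE]
    rw [relEnergy_congr hf₀, relEnergy_eq_ofReal hn hs hs1 hΩ hb hLip hN hφ href hrefN]
    exact ENNReal.ofReal_lt_top
  have huW : u ∈ WExt s Ω φ := mem_WExt_of_relEnergy_lt_top hn hs1 hΩ hb hN (hfm f)
    (hbdd f) (fun x hx => truncate_of_notMem hx _ _ _) hlt
  refine ⟨u, ⟨huW, ?_⟩, hbdd f, fun v hv hvN => ?_⟩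
  · filter_upwards [ae_restrict_of_ae_restrict_of_subset hAΩ hfC, ae_restrict_mem hA] with x hx hxA
    rw [hu, truncate_of_mem (hAΩ hxA), clamp_of_abs_le hx.1]
    exact hx.2 hxA
  · obtain ⟨g, hgC, hg⟩ := hrep v hv hvN
    refine (relEnergy_le_iff_integral_nonpos hn hs hs1 hΩ hb hLip hN hφ huW (hbdd f) hv.1 hvN).1 ?_
    rw [← relEnergy_congr hg]
    exact hfmin g hgC

/-! ### Uniqueness and the obstacle problem -/

lemma midpoint_mem_WObst {Ω A : Set (Eucl n)} (hΩ : MeasurableSet Ω) {φ ψ u w : Eucl n → ℝ}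
    (hu : u ∈ WObst s Ω A φ ψ) (hw : w ∈ WObst s Ω A φ ψ) :
    (fun x => (u x + w x) / 2) ∈ WObst s Ω A φ ψ := by
  refine ⟨⟨W_of_abs_sub_le hΩ hu.1.1 hw.1.1 ((hu.1.1.1.add hw.1.1.1).div_const 2)
    fun x _ y _ => ?_, fun x hx => ?_⟩, ?_⟩
  · rw [show (u x + w x) / 2 - (u y + w y) / 2 = ((u x - u y) + (w x - w y)) / 2 by ring,
      abs_div, abs_two]
    have := abs_add_le (u x - u y) (w x - w y)
    have := abs_nonneg ((u x - u y) + (w x - w y))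
    linarith
  · simp only [hu.1.2 x hx, hw.1.2 x hx, add_self_div_two]
  · filter_upwards [hu.2, hw.2] with x hx hx'
    linarith

lemma volume_compl_ne_zero (hn : 1 ≤ n) {Ω : Set (Eucl n)} (hb : Bornology.IsBounded Ω) :
    volume Ωᶜ ≠ 0 := by
  have : NeZero n := ⟨by omega⟩
  intro h
  have h1 : volume (Set.univ : Set (Eucl n)) ≤ volume Ω + volume Ωᶜ := by
    rw [← Set.union_compl_self Ω]; exact measure_union_le _ _
  rw [h, add_zero, measure_univ_of_isAddLeftInvariant] at h1
  exact absurd hb.measure_lt_top (not_lt.2 h1)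

/-- Uniqueness of solutions: the midpoint of two distinct solutions would have less energy, by
strict convexity of `𝒢_s`, unless the two solutions differ by a constant; the exterior datum
excludes this. -/
theorem SolvesObstacleProblem.ae_eq (hn : 1 ≤ n) {Ω A : Set (Eucl n)} (hΩ : IsOpen Ω)
    (hb : Bornology.IsBounded Ω) {φ ψ u w : Eucl n → ℝ} (hu : SolvesObstacleProblem s Ω A φ ψ u)
    (hw : SolvesObstacleProblem s Ω A φ ψ w) : w =ᵐ[volume] u := by
  have hmid := midpoint_mem_WObst hΩ.measurableSet hu.1 hw.1
  obtain ⟨hui, hule⟩ := hu.2 _ hmid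
  obtain ⟨hwi, hwle⟩ := hw.2 _ hmid
  set v : Eucl n → ℝ := fun x => (u x + w x) / 2 with hv
  have hvp : ∀ p : Eucl n × Eucl n, v p.1 - v p.2 = ((u p.1 - u p.2) + (w p.1 - w p.2)) / 2 :=
    fun p => by simp only [hv]; ring
  set f : Eucl n × Eucl n → ℝ := fun p => (areaIntegrand n s u p - areaIntegrand n s v p) +
    (areaIntegrand n s w p - areaIntegrand n s v p) with hf
  have hf0 : ∀ p, 0 ≤ f p := fun p => by
    have h := pairEnergy_convex (n := n) (s := s) (norm_nonneg (p.1 - p.2)) one_half_pos.le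
      one_half_pos.le (add_halves 1) (u p.1 - u p.2) (w p.1 - w p.2)
    simp only [hf, areaIntegrand_eq, hvp]
    rw [show ((u p.1 - u p.2) + (w p.1 - w p.2)) / 2 =
      1 / 2 * (u p.1 - u p.2) + 1 / 2 * (w p.1 - w p.2) by ring]
    linarith
  have hfint : ∫ p in Q Ω, f p = 0 := by
    refine le_antisymm ?_ (integral_nonneg hf0)
    rw [hf, integral_add hui hwi]
    linarith
  have hae := (setIntegral_eq_zero_iff_of_nonneg_ae (Filter.Eventually.of_forall hf0)
    (hui.add hwi)).1 hfint
  rw [Filter.EventuallyEq, ae_restrict_iff' (measurableSet_Q hΩ.measurableSet)] at hae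
  have hdiff : ∀ᵐ p : Eucl n × Eucl n, p ∈ Q Ω → u p.1 - u p.2 = w p.1 - w p.2 := by
    filter_upwards [hae] with p hp hpQ
    by_contra hne
    have hpos : 0 < ‖p.1 - p.2‖ := norm_pos_iff.2 fun h => hne (by
      rw [sub_eq_zero.1 h, sub_self, sub_self])
    have h1 := pairEnergy_midpoint_lt (n := n) (s := s) hpos hne
    have h2 := hp hpQ
    simp only [hf, areaIntegrand_eq, hvp, Pi.zero_apply] at h2
    linarith
  have hnull : volume ((Ω ∩ {x | u x ≠ w x}) ×ˢ Ωᶜ) = 0 := by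
    refine measure_mono_null (t := {p | ¬(p ∈ Q Ω → u p.1 - u p.2 = w p.1 - w p.2)}) ?_
      (ae_iff.1 hdiff)
    intro p hp hpd
    have hpQ : p ∈ Q Ω := fun h => h.1 hp.1.1
    have h1 := hpd hpQ
    rw [hu.1.1.2 _ hp.2, hw.1.1.2 _ hp.2] at h1
    exact hp.1.2 (by linarith)
  rw [Measure.volume_eq_prod, Measure.prod_prod, mul_eq_zero,
    or_iff_left (volume_compl_ne_zero hn hb)] at hnull
  refine measure_mono_null (fun x hx => ?_) hnull
  by_cases hxΩ : x ∈ Ω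
  · exact ⟨hxΩ, fun h => hx h.symm⟩
  · exact absurd (by rw [Set.mem_ofPred_eq, hu.1.1.2 x hxΩ, hw.1.1.2 x hxΩ]) hx

lemma ae_abs_le_toReal_eLpNorm {f : Eucl n → ℝ} {μ : Measure (Eucl n)} (hf : MemLp f ⊤ μ) :
    ∀ᵐ x ∂μ, |f x| ≤ (eLpNorm f ⊤ μ).toReal := by
  have h := ae_le_eLpNormEssSup (f := f) (μ := μ)
  rw [← eLpNorm_exponent_top] at h
  filter_upwards [h] with x hx
  rw [Real.enorm_eq_ofReal_abs] at hx
  exact (ENNReal.ofReal_le_iff_le_toReal hf.2.ne).1 hx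

lemma truncate_mem_WObst {Ω A : Set (Eucl n)} (hΩ : MeasurableSet Ω)
    (hb : Bornology.IsBounded Ω) (hA : MeasurableSet A) (hAΩ : A ⊆ Ω) {N : ℝ} (hN : 0 ≤ N)
    {φ ψ u : Eucl n → ℝ} (hψ : ∀ᵐ x ∂volume.restrict A, ψ x ≤ N) (hu : u ∈ WObst s Ω A φ ψ) :
    truncate Ω N u u ∈ WObst s Ω A φ ψ := by
  refine ⟨truncate_mem_WExt hΩ hb hN hu.1, ?_⟩
  filter_upwards [hψ, hu.2, ae_restrict_mem hA] with x h1 h2 hxA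
  rw [truncate_of_mem (hAΩ hxA)]
  exact le_max_of_le_right (le_min h2 h1)

end NonlocalObstacle

open NonlocalObstacle in
theorem theorem2p2 (n : ℕ) (hn : 1 ≤ n) (s : ℝ) (hs : s ∈ Set.Ioo (0 : ℝ) 1) :
    ∃ Θ : ℝ, 1 < Θ ∧
      ∀ (Ω A : Set (NonlocalObstacle.Eucl n)) (ψ φ : NonlocalObstacle.Eucl n → ℝ),
        IsOpen Ω → Bornology.IsBounded Ω → NonlocalObstacle.HasLipschitzBoundary Ω →
        IsOpen A → A ⊆ Ω →
        MemLp ψ ⊤ (volume.restrict A) →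
        AEMeasurable φ (volume.restrict Ωᶜ) →
        MemLp φ ⊤
          (volume.restrict (NonlocalObstacle.neighborhood Ω (Θ * Metric.diam Ω) \ Ω)) →
        ∃ u : NonlocalObstacle.Eucl n → ℝ,
          NonlocalObstacle.SolvesObstacleProblem s Ω A φ ψ u ∧
          (∀ w : NonlocalObstacle.Eucl n → ℝ,
            NonlocalObstacle.SolvesObstacleProblem s Ω A φ ψ w → w =ᵐ[volume] u) ∧
          eLpNorm u ⊤ (volume.restrict Ω) ≤
            ENNReal.ofReal (Metric.diam Ω) +
              max
                (eLpNorm φ ⊤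
                  (volume.restrict
                    (NonlocalObstacle.neighborhood Ω (Θ * Metric.diam Ω) \ Ω)))
                (eLpNorm ψ ⊤ (volume.restrict A)) := by
  obtain ⟨Θ, hΘ⟩ := exists_isAdmissibleRatio hn hs.1
  refine ⟨Θ, by linarith [hΘ.1], fun Ω A ψ φ hΩ hb hLip hA hAΩ hψ hφm hφ => ?_⟩
  set M := max (eLpNorm φ ⊤ (volume.restrict (neighborhood Ω (Θ * Metric.diam Ω) \ Ω)))
    (eLpNorm ψ ⊤ (volume.restrict A)) with hM
  have hMtop : M ≠ ⊤ := (max_lt hφ.2 hψ.2).ne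
  have hm0 : 0 ≤ M.toReal := ENNReal.toReal_nonneg
  have hD0 : 0 ≤ Metric.diam Ω := Metric.diam_nonneg
  have hφM : ∀ᵐ y ∂volume.restrict (neighborhood Ω (Θ * Metric.diam Ω) \ Ω), |φ y| ≤ M.toReal := by
    filter_upwards [ae_abs_le_toReal_eLpNorm hφ] with y hy
    exact hy.trans (ENNReal.toReal_mono hMtop (le_max_left _ _))
  have hψN : ∀ᵐ x ∂volume.restrict A, ψ x ≤ Metric.diam Ω + M.toReal := by
    filter_upwards [ae_abs_le_toReal_eLpNorm hψ] with x hx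
    have h1 := hx.trans (ENNReal.toReal_mono hMtop (le_max_right _ _))
    linarith [le_abs_self (ψ x)]
  obtain ⟨u, hu, huN, hmin⟩ := exists_bounded_minimizer hn hs.1 hs.2 hΩ hb hLip hA.measurableSet
    hAΩ (add_nonneg hD0 hm0) hφm hψN
  have hsol : SolvesObstacleProblem s Ω A φ ψ u := by
    refine ⟨hu, fun v hv => ⟨integrableOn_areaIntegrand_sub hn hs.1 hs.2 hΩ hb hLip hφm hu.1 hv.1,
      ?_⟩⟩
    have hT := truncate_mem_WObst hΩ.measurableSet hb hA.measurableSet hAΩ (add_nonneg hD0 hm0)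
      hψN hv
    have h1 := hmin _ hT fun x hx => by
      rw [truncate_of_mem hx]; exact abs_clamp_le (add_nonneg hD0 hm0) _
    have h2 := integral_sub_truncate_nonneg hn hs.1 hs.2 hΩ hb hLip hΘ hm0 hφm hφM hv.1
    have h3 := integral_sub
      (integrableOn_areaIntegrand_sub hn hs.1 hs.2 hΩ hb hLip hφm hu.1 hT.1)
      (integrableOn_areaIntegrand_sub hn hs.1 hs.2 hΩ hb hLip hφm hv.1 hT.1)
    simp only [sub_sub_sub_cancel_right] at h3
    linarith
  refine ⟨u, hsol, fun w hw => hsol.ae_eq hn hΩ hb hw, ?_⟩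
  rw [eLpNorm_exponent_top]
  refine (eLpNormEssSup_le_of_ae_bound (C := Metric.diam Ω + M.toReal)
    ((ae_restrict_iff' hΩ.measurableSet).2 (Filter.Eventually.of_forall huN))).trans_eq ?_
  rw [ENNReal.ofReal_add hD0 hm0, ENNReal.ofReal_toReal hMtop]
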